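/- **Definitions.** A *geometric realization* of a simple graph $G$ is a straight-line drawing of $G$ in the plane whose vertices are distinct points in general position: no three vertices are collinear and no three edges cross at a single point. Two distinct edges *cross* if they have a common interior point; a realization without crossings is *plane*. A *geometric isomorphism* between two realizations of $G$ is a bijection of the vertices that preserves adjacency, non-adjacency, crossings and non-crossings. For realizations $\overline G,\widehat G$ of $G$ put $\overline G\preceq\widehat G$ if there is an injective vertex map $\overline G\to\widehat G$ that preserves adjacencies and crossings. For finite $G$ this induces a partial order on the set of geometric isomorphism classes of realizations of $G$. Let $\mathcal K_n$ be the resulting poset for the complete graph $K_n$ with vertices $1,\dots,n$. We write $ij\times kl$ for a crossing of the edges $\{i,j\}$ and $\{k,l\}$, and we describe a realization of $K_n$ by its set of crossings, which determines its isomorphism class. **Theorem.** 1. $\mathcal K_3$ has exactly one element, the plane realization. 2. $\mathcal K_4$ is a chain of two elements: the plane realization is its unique minimal element, and the realization whose only crossing is $13\times 24$ is its unique maximal element. 3. $\mathcal K_5$ is a chain of exactly three elements $1.1\prec 3.1\prec 5.1$ with $1$, $3$ and $5$ crossings, where $1.1=\{35\times 24\}$, $3.1=\{14\times 25,\ 14\times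 35,\ 24\times 35\}$ and $5.1=\{13\times 24,\ 13\times 25,\ 14\times 25,\ 14\times 35,\ 24\times 35\}$. 4. $\mathcal K_6$ has exactly fifteen elements. They are pairwise non-isomorphic realizations with the following sets of crossings (the name $c.k$ denotes the $k$-th realization with $c$ crossings): - $3.1=\{13\times 26,\ 14\times 25,\ 35\times 46\}$; - $4.1=\{13\times 26,\ 14\times 35,\ 14\times 56,\ 35\times 46\}$; - $5.1=\{13\times 24,\ 13\times 26,\ 14\times 26,\ 14\times 36,\ 24\times 36\}$; - $5.2=\{13\times 26,\ 14\times 26,\ 14\times 35,\ 14\times 36,\ 35\times 46\}$; - $6.1=\{14\times 25,\ 14\times 26,\ 14\times 36,\ 24\times 36,\ 25\times 36,\ 25\times 46\}$; - $7.1=\{13\times 25,\ 13\times 26,\ 14\times 25,\ 14\times 35,\ 14\times 56,\ 16\times 25,\ 35\times 46\}$; - $7.2=\{13\times 26,\ 14\times 25,\ 14\times 35,\ 15\times 46,\ 24\times 35,\ 25\times 46,\ 35\times 46\}$; - $8.1=\{13\times 24,\ 13\times 26,\ 14\times 35,\ 14\times 56,\ 16\times 24,\ 24\times 35,\ 24\times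 56,\ 35\times 46\}$; - $8.2=\{13\times 24,\ 13\times 26,\ 14\times 26,\ 14\times 36,\ 15\times 26,\ 15\times 36,\ 15\times 46,\ 24\times 36\}$; - $9.1=\{13\times 25,\ 13\times 26,\ 14\times 25,\ 14\times 26,\ 14\times 35,\ 14\times 36,\ 25\times 36,\ 25\times 46,\ 35\times 46\}$; - $9.2=\{13\times 24,\ 13\times 25,\ 13\times 26,\ 14\times 25,\ 14\times 26,\ 14\times 36,\ 24\times 36,\ 25\times 36,\ 25\times 46\}$; - $10.1=\{13\times 24,\ 13\times 25,\ 13\times 26,\ 14\times 25,\ 14\times 35,\ 14\times 56,\ 16\times 25,\ 24\times 35,\ 24\times 36,\ 35\times 46\}$; - $11.1=\{13\times 24,\ 13\times 25,\ 13\times 26,\ 14\times 25,\ 14\times 35,\ 14\times 56,\ 16\times 24,\ 16\times 25,\ 24\times 35,\ 24\times 56,\ 35\times 46\}$; - $12.1=\{13\times 24,\ 13\times 25,\ 13\times 26,\ 14\times 25,\ 14\times 26,\ 14\times 35,\ 14\times 36,\ 24\times 35,\ 24\times 36,\ 25\times 36,\ 25\times 46,\ 35\times 46\}$; - $15.1=\{13\times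 24,\ 13\times 25,\ 13\times 26,\ 14\times 25,\ 14\times 26,\ 14\times 35,\ 14\times 36,\ 15\times 26,\ 15\times 36,\ 15\times 46,\ 24\times 35,\ 24\times 36,\ 25\times 36,\ 25\times 46,\ 35\times 46\}$. The covering relations of $\mathcal K_6$ (its Hasse diagram) are exactly the following: - $3.1$ is covered by $7.1,\ 7.2,\ 8.1,\ 9.1$; - $4.1$ is covered by $7.1,\ 7.2,\ 8.1,\ 8.2,\ 9.2$; - $5.1$ is covered by $8.2,\ 9.2,\ 10.1$; - $5.2$ is covered by $8.1,\ 8.2,\ 9.1$; - $6.1$ is covered by $9.2$; - $7.1$ is covered by $10.1,\ 11.1$; - $7.2$ is covered by $15.1$; - $8.1$ is covered by $11.1$; - $8.2$ is covered by $11.1,\ 12.1$; - $9.1$ is covered by $12.1$; - $9.2$ is covered by $12.1$; - $12.1$ is covered by $15.1$; - $10.1$, $11.1$ and $15.1$ are maximal. -/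

import Mathlib

namespace GeomGraph

/-- A geometric realization of a simple graph `G`: a straight-line drawing of `G` in the plane, the
edge `ab` being the segment from `pos a` to `pos b`, with the vertices in general position (no three
vertices are collinear and no three edges cross at a single point). -/
structure Realization {V : Type*} (G : SimpleGraph V) where
  pos : V → ℝ × ℝ
  pos_injective : Function.Injective pos
  not_collinear : ∀ a b c : V, a ≠ b → a ≠ c → b ≠ c →
    ¬ Collinear ℝ ({pos a, pos b, pos c} : Set (ℝ × ℝ))
  not_concurrent : ∀ a b c d e f : V, G.Adj a b → G.Adj c d → G.Adj e f →
    s(a, b) ≠ s(c, d) → s(a, b) ≠ s(e, f) → s(c, d) ≠ s(e, f) →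
    ¬ (openSegment ℝ (pos a) (pos b) ∩ openSegment ℝ (pos c) (pos d) ∩
        openSegment ℝ (pos e) (pos f)).Nonempty

section Maps

variable {V : Type*} {W : Type*} {U : Type*}
variable {G : SimpleGraph V} {H : SimpleGraph W} {K : SimpleGraph U}

/-- `ab` and `cd` are distinct edges of the realization, and they have a common interior point. -/
def Realization.Crosses (A : Realization G) (a b c d : V) : Prop :=
  G.Adj a b ∧ G.Adj c d ∧ s(a, b) ≠ s(c, d) ∧
    (openSegment ℝ (A.pos a) (A.pos b) ∩ openSegment ℝ (A.pos c) (A.pos d)).Nonempty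

/-- The set of all crossings of a realization; a crossing is an unordered pair of edges. -/
def Realization.crossingSet (A : Realization G) : Set (Sym2 (Sym2 V)) :=
  {x | ∃ a b c d : V, A.Crosses a b c d ∧ x = s(s(a, b), s(c, d))}

/-- A plane realization is one without crossings. -/
def Realization.IsPlane (A : Realization G) : Prop :=
  ∀ a b c d : V, ¬ A.Crosses a b c d

/-- Geometric isomorphisms. -/
structure IsGeomIso (A : Realization G) (B : Realization H) (f : V → W) : Prop where
  bijective : Function.Bijective f
  adj_iff : ∀ u v : V, G.Adj u v ↔ H.Adj (f u) (f v)
  crosses_iff : ∀ x y u v : V, A.Crosses x y u v ↔ B.Crosses (f x) (f y) (f u) (f v)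

/-- Geometric homomorphisms. -/
structure IsGeomHom (A : Realization G) (B : Realization H) (f : V → W) : Prop where
  map_adj : ∀ u v : V, G.Adj u v → H.Adj (f u) (f v)
  map_crosses : ∀ x y u v : V, A.Crosses x y u v → B.Crosses (f x) (f y) (f u) (f v)

theorem IsGeomIso.isGeomHom {A : Realization G} {B : Realization H} {f : V → W}
    (h : IsGeomIso A B f) : IsGeomHom A B f :=
  ⟨fun u v => (h.adj_iff u v).1, fun x y u v => (h.crosses_iff x y u v).1⟩

theorem IsGeomHom.comp {A : Realization G} {B : Realization H} {C : Realization K}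
    {g : W → U} {f : V → W} (hg : IsGeomHom B C g) (hf : IsGeomHom A B f) :
    IsGeomHom A C (g ∘ f) :=
  ⟨fun u v h => hg.map_adj _ _ (hf.map_adj u v h),
    fun x y u v h => hg.map_crosses _ _ _ _ (hf.map_crosses x y u v h)⟩

theorem IsGeomHom.iterate {A : Realization G} {f : V → V} (hf : IsGeomHom A A f) (k : ℕ) :
    IsGeomHom A A f^[k] := by
  induction k with
  | zero => exact ⟨fun _ _ h => h, fun _ _ _ _ h => h⟩
  | succ k ih =>
    rw [Function.iterate_succ]
    exact ih.comp hf

/-- Geometric isomorphism is an equivalence relation on the realizations of `G`. -/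
instance Realization.isoSetoid (G : SimpleGraph V) : Setoid (Realization G) where
  r A B := ∃ f : V → V, IsGeomIso A B f
  iseqv := by
    refine ⟨fun A => ⟨id, Function.bijective_id, fun _ _ => Iff.rfl, fun _ _ _ _ => Iff.rfl⟩,
      ?_, ?_⟩
    · rintro A B ⟨f, hf⟩
      obtain ⟨g, hgf, hfg⟩ := Function.bijective_iff_has_inverse.1 hf.bijective
      refine ⟨g, Function.bijective_iff_has_inverse.2 ⟨f, hfg, hgf⟩, fun u v => ?_,
        fun x y u v => ?_⟩
      · rw [hf.adj_iff (g u) (g v), hfg, hfg]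
      · rw [hf.crosses_iff (g x) (g y) (g u) (g v), hfg, hfg, hfg, hfg]
    · rintro A B C ⟨f, hf⟩ ⟨g, hg⟩
      exact ⟨g ∘ f, hg.bijective.comp hf.bijective,
        fun u v => (hf.adj_iff u v).trans (hg.adj_iff _ _),
        fun x y u v => (hf.crosses_iff x y u v).trans (hg.crosses_iff _ _ _ _)⟩

/-- The relation `A ≼ B`: there is an injective geometric homomorphism from `A` to `B`. -/
def Realization.Precedes (A B : Realization G) : Prop :=
  ∃ f : V → V, Function.Injective f ∧ IsGeomHom A B f

theorem Realization.Precedes.trans {A B C : Realization G} (h₁ : A.Precedes B)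
    (h₂ : B.Precedes C) : A.Precedes C := by
  obtain ⟨f, hf, hf2⟩ := h₁
  obtain ⟨g, hg, hg2⟩ := h₂
  exact ⟨g ∘ f, hg.comp hf, hg2.comp hf2⟩

theorem Realization.precedes_of_equiv {A B : Realization G} (h : A ≈ B) : A.Precedes B := by
  obtain ⟨f, hf⟩ := h
  exact ⟨f, hf.bijective.injective, hf.isGeomHom⟩

theorem Realization.Precedes.antisymm [Finite V] {A B : Realization G} (h₁ : A.Precedes B)
    (h₂ : B.Precedes A) : A ≈ B := by
  obtain ⟨f, hf, hf2⟩ := h₁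
  obtain ⟨g, hg, hg2⟩ := h₂
  let σ : Equiv.Perm V := Equiv.ofBijective (g ∘ f) (Finite.injective_iff_bijective.1 (hg.comp hf))
  obtain ⟨k, hk, hσ⟩ := (isOfFinOrder_iff_pow_eq_one (x := σ)).1 (isOfFinOrder_of_finite σ)
  obtain ⟨m, rfl⟩ : ∃ m, k = m + 1 := ⟨k - 1, by omega⟩
  have hr : IsGeomHom B A ((g ∘ f)^[m] ∘ g) := ((hg2.comp hf2).iterate m).comp hg2
  have hid : ∀ v, ((g ∘ f)^[m] ∘ g) (f v) = v := by
    intro v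
    have h : (σ ^ (m + 1)) v = v := by rw [hσ]; rfl
    rw [Equiv.Perm.coe_pow] at h
    exact h
  refine ⟨f, Finite.injective_iff_bijective.1 hf, fun u v => ⟨hf2.map_adj u v, fun h => ?_⟩,
    fun x y u v => ⟨hf2.map_crosses x y u v, fun h => ?_⟩⟩
  · simpa only [hid] using hr.map_adj _ _ h
  · simpa only [hid] using hr.map_crosses _ _ _ _ h

/-- The set of geometric isomorphism classes of realizations of `G`. -/
def HomPoset (G : SimpleGraph V) : Type _ :=
  Quotient (Realization.isoSetoid G)

/-- The geometric isomorphism class of a realization. -/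
def Realization.toClass (A : Realization G) : HomPoset G :=
  Quotient.mk (Realization.isoSetoid G) A

/-- The geometric homomorphism poset of `G`: the isomorphism classes of its realizations, ordered
by the relation `≼`. -/
instance HomPoset.partialOrder [Finite V] (G : SimpleGraph V) : PartialOrder (HomPoset G) where
  le := Quotient.lift₂ Realization.Precedes fun _ _ _ _ h₁ h₂ => propext
    ⟨fun h => ((Realization.precedes_of_equiv (Setoid.symm h₁)).trans h).trans
        (Realization.precedes_of_equiv h₂),
      fun h => ((Realization.precedes_of_equiv h₁).trans h).trans
        (Realization.precedes_of_equiv (Setoid.symm h₂))⟩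
  le_refl := by
    rintro ⟨A⟩
    exact Realization.precedes_of_equiv (Setoid.refl A)
  le_trans := by
    rintro ⟨A⟩ ⟨B⟩ ⟨C⟩ h₁ h₂
    exact Realization.Precedes.trans h₁ h₂
  le_antisymm := by
    rintro ⟨A⟩ ⟨B⟩ h₁ h₂
    exact Quotient.sound (Realization.Precedes.antisymm h₁ h₂)

theorem Realization.toClass_le_iff [Finite V] {A B : Realization G} :
    A.toClass ≤ B.toClass ↔ A.Precedes B :=
  Iff.rfl

end Maps

/-- Geometric realizations of the complete graph on `n` vertices. -/
abbrev KRealization (n : ℕ) : Type :=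
  Realization (⊤ : SimpleGraph (Fin n))

/-- The poset of geometric realizations of the complete graph on `n` vertices. -/
abbrev KPoset (n : ℕ) : Type :=
  HomPoset (⊤ : SimpleGraph (Fin n))

/-! In the crossing lists below the vertices of the complete graph on `n` vertices carry the labels
`1, …, n`; in `Fin n` the numeral `n` denotes the element `0`, so these are `n` different elements. -/

/-- The crossings of the realizations `1.1`, `3.1` and `5.1` of the complete graph on five
vertices, in this order. -/
def k5Crossings : Fin 3 → Finset (Sym2 (Sym2 (Fin 5))) :=
  ![{ s(s(3, 5), s(2, 4)) },
    { s(s(1, 4), s(2, 5)), s(s(1, 4), s(3, 5)), s(s(2, 4), s(3, 5)) },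
    { s(s(1, 3), s(2, 4)), s(s(1, 3), s(2, 5)), s(s(1, 4), s(2, 5)), s(s(1, 4), s(3, 5)),
      s(s(2, 4), s(3, 5)) }]

/-- Names for the realizations of the complete graph on six vertices: `rc_k` is the `k`-th
realization with `c` crossings. -/
inductive K6Name where
  | r3_1 | r4_1 | r5_1 | r5_2 | r6_1
  | r7_1 | r7_2 | r8_1 | r8_2 | r9_1
  | r9_2 | r10_1 | r11_1 | r12_1 | r15_1
  deriving DecidableEq

/-- The number of crossings. -/
def K6Name.count : K6Name → ℕ
  | .r3_1 => 3
  | .r4_1 => 4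
  | .r5_1 => 5
  | .r5_2 => 5
  | .r6_1 => 6
  | .r7_1 => 7
  | .r7_2 => 7
  | .r8_1 => 8
  | .r8_2 => 8
  | .r9_1 => 9
  | .r9_2 => 9
  | .r10_1 => 10
  | .r11_1 => 11
  | .r12_1 => 12
  | .r15_1 => 15

/-- The crossings of the fifteen realizations of the complete graph on six vertices. -/
def K6Name.crossings : K6Name → Finset (Sym2 (Sym2 (Fin 6)))
  | .r3_1 =>
    { s(s(1, 3), s(2, 6)), s(s(1, 4), s(2, 5)), s(s(3, 5), s(4, 6)) }
  | .r4_1 =>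
    { s(s(1, 3), s(2, 6)), s(s(1, 4), s(3, 5)), s(s(1, 4), s(5, 6)), s(s(3, 5), s(4, 6)) }
  | .r5_1 =>
    { s(s(1, 3), s(2, 4)), s(s(1, 3), s(2, 6)), s(s(1, 4), s(2, 6)), s(s(1, 4), s(3, 6)),
      s(s(2, 4), s(3, 6)) }
  | .r5_2 =>
    { s(s(1, 3), s(2, 6)), s(s(1, 4), s(2, 6)), s(s(1, 4), s(3, 5)), s(s(1, 4), s(3, 6)),
      s(s(3, 5), s(4, 6)) }
  | .r6_1 =>
    { s(s(1, 4), s(2, 5)), s(s(1, 4), s(2, 6)), s(s(1, 4), s(3, 6)), s(s(2, 4), s(3, 6)),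
      s(s(2, 5), s(3, 6)), s(s(2, 5), s(4, 6)) }
  | .r7_1 =>
    { s(s(1, 3), s(2, 5)), s(s(1, 3), s(2, 6)), s(s(1, 4), s(2, 5)), s(s(1, 4), s(3, 5)),
      s(s(1, 4), s(5, 6)), s(s(1, 6), s(2, 5)), s(s(3, 5), s(4, 6)) }
  | .r7_2 =>
    { s(s(1, 3), s(2, 6)), s(s(1, 4), s(2, 5)), s(s(1, 4), s(3, 5)), s(s(1, 5), s(4, 6)),
      s(s(2, 4), s(3, 5)), s(s(2, 5), s(4, 6)), s(s(3, 5), s(4, 6)) }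
  | .r8_1 =>
    { s(s(1, 3), s(2, 4)), s(s(1, 3), s(2, 6)), s(s(1, 4), s(3, 5)), s(s(1, 4), s(5, 6)),
      s(s(1, 6), s(2, 4)), s(s(2, 4), s(3, 5)), s(s(2, 4), s(5, 6)), s(s(3, 5), s(4, 6)) }
  | .r8_2 =>
    { s(s(1, 3), s(2, 4)), s(s(1, 3), s(2, 6)), s(s(1, 4), s(2, 6)), s(s(1, 4), s(3, 6)),
      s(s(1, 5), s(2, 6)), s(s(1, 5), s(3, 6)), s(s(1, 5), s(4, 6)), s(s(2, 4), s(3, 6)) }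
  | .r9_1 =>
    { s(s(1, 3), s(2, 5)), s(s(1, 3), s(2, 6)), s(s(1, 4), s(2, 5)), s(s(1, 4), s(2, 6)),
      s(s(1, 4), s(3, 5)), s(s(1, 4), s(3, 6)), s(s(2, 5), s(3, 6)), s(s(2, 5), s(4, 6)),
      s(s(3, 5), s(4, 6)) }
  | .r9_2 =>
    { s(s(1, 3), s(2, 4)), s(s(1, 3), s(2, 5)), s(s(1, 3), s(2, 6)), s(s(1, 4), s(2, 5)),
      s(s(1, 4), s(2, 6)), s(s(1, 4), s(3, 6)), s(s(2, 4), s(3, 6)), s(s(2, 5), s(3, 6)),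
      s(s(2, 5), s(4, 6)) }
  | .r10_1 =>
    { s(s(1, 3), s(2, 4)), s(s(1, 3), s(2, 5)), s(s(1, 3), s(2, 6)), s(s(1, 4), s(2, 5)),
      s(s(1, 4), s(3, 5)), s(s(1, 4), s(5, 6)), s(s(1, 6), s(2, 5)), s(s(2, 4), s(3, 5)),
      s(s(2, 4), s(3, 6)), s(s(3, 5), s(4, 6)) }
  | .r11_1 =>
    { s(s(1, 3), s(2, 4)), s(s(1, 3), s(2, 5)), s(s(1, 3), s(2, 6)), s(s(1, 4), s(2, 5)),
      s(s(1, 4), s(3, 5)), s(s(1, 4), s(5, 6)), s(s(1, 6), s(2, 4)), s(s(1, 6), s(2, 5)),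
      s(s(2, 4), s(3, 5)), s(s(2, 4), s(5, 6)), s(s(3, 5), s(4, 6)) }
  | .r12_1 =>
    { s(s(1, 3), s(2, 4)), s(s(1, 3), s(2, 5)), s(s(1, 3), s(2, 6)), s(s(1, 4), s(2, 5)),
      s(s(1, 4), s(2, 6)), s(s(1, 4), s(3, 5)), s(s(1, 4), s(3, 6)), s(s(2, 4), s(3, 5)),
      s(s(2, 4), s(3, 6)), s(s(2, 5), s(3, 6)), s(s(2, 5), s(4, 6)), s(s(3, 5), s(4, 6)) }
  | .r15_1 =>
    { s(s(1, 3), s(2, 4)), s(s(1, 3), s(2, 5)), s(s(1, 3), s(2, 6)), s(s(1, 4), s(2, 5)),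
      s(s(1, 4), s(2, 6)), s(s(1, 4), s(3, 5)), s(s(1, 4), s(3, 6)), s(s(1, 5), s(2, 6)),
      s(s(1, 5), s(3, 6)), s(s(1, 5), s(4, 6)), s(s(2, 4), s(3, 5)), s(s(2, 4), s(3, 6)),
      s(s(2, 5), s(3, 6)), s(s(2, 5), s(4, 6)), s(s(3, 5), s(4, 6)) }

/-- The Hasse diagram on the fifteen names: the elements that cover a given one. -/
def K6Name.upperCovers : K6Name → Finset K6Name
  | .r3_1 => {.r7_1, .r7_2, .r8_1, .r9_1}
  | .r4_1 => {.r7_1, .r7_2, .r8_1, .r8_2, .r9_2}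
  | .r5_1 => {.r8_2, .r9_2, .r10_1}
  | .r5_2 => {.r8_1, .r8_2, .r9_1}
  | .r6_1 => {.r9_2}
  | .r7_1 => {.r10_1, .r11_1}
  | .r7_2 => {.r15_1}
  | .r8_1 => {.r11_1}
  | .r8_2 => {.r11_1, .r12_1}
  | .r9_1 => {.r12_1}
  | .r9_2 => {.r12_1}
  | .r10_1 => ∅
  | .r11_1 => ∅
  | .r12_1 => {.r15_1}
  | .r15_1 => ∅

end GeomGraph

/-! Whether two edges cross depends only on the orientation signs of the triples of their ends
(`Realization.crosses_iff_of_distinct`), so a realization matters only through its order type, and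
for each `n ≤ 6` there are few candidates. Take an extreme vertex first and the others
counterclockwise around it (`Realization.exists_radial_order`): every triple with the first vertex
is positive, and for `n = 6` only ten signs remain free. The three-term Grassmann-Plücker relations
are a necessary condition on these signs, and every one of the 1024 words that satisfies them is
listed in a table together with a relabelling onto one of the fifteen crossing sets (`k6_words`,
`k6_table`). This bounds the poset from above. Explicit integer points in general position show that
all fifteen sets occur (`exists_realization`).

For complete graphs the order is combinatorial: one class is below another if a permutation of the
vertices carries the first crossing set into the second (`Realization.precedes_iff`). The covering
relations come with explicit permutations (`k6_coverMap`). For the absence of further relations, all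
720 permutations are tried on 25 pairs (`k6_separated_noEmbedding`); any other relation outside the
diagram would, by transitivity, produce one of these. This gives `k6_le_iff`, from which
non-isomorphism and the Hasse diagram are read off. Four and five vertices use the same table
method, and strictness there is a count of crossings. -/

namespace GeomGraph

/-! ### Orientations of triples and crossing segments -/

/-- Twice the signed area of the triangle `pqr`. -/
def orient (p q r : ℝ × ℝ) : ℝ :=
  (q.1 - p.1) * (r.2 - p.2) - (q.2 - p.2) * (r.1 - p.1)

theorem orient_swap_left (p q r : ℝ × ℝ) : orient q p r = -orient p q r := by
  unfold orient; ring

theorem orient_swap_right (p q r : ℝ × ℝ) : orient p r q = -orient p q r := by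
  unfold orient; ring

theorem orient_rotate (p q r : ℝ × ℝ) : orient q r p = orient p q r := by
  unfold orient; ring

theorem orient_combination (p q r s : ℝ × ℝ) (α β : ℝ) (h : α + β = 1) :
    orient p q (α • r + β • s) = α * orient p q r + β * orient p q s := by
  obtain rfl : α = 1 - β := by linarith
  simp only [orient, Prod.fst_add, Prod.snd_add, Prod.smul_fst, Prod.smul_snd, smul_eq_mul]
  ring

theorem orient_self_left (p q : ℝ × ℝ) : orient p q p = 0 := by
  unfold orient; ring

theorem orient_self_right (p q : ℝ × ℝ) : orient p q q = 0 := by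
  unfold orient; ring

theorem collinear_triple_iff {p q r : ℝ × ℝ} (hpq : p ≠ q) :
    Collinear ℝ ({p, q, r} : Set (ℝ × ℝ)) ↔ orient p q r = 0 := by
  rw [collinear_iff_of_mem (p₀ := p) (by simp)]
  constructor
  · rintro ⟨v, hv⟩
    obtain ⟨a, ha⟩ := hv q (by simp)
    obtain ⟨b, hb⟩ := hv r (by simp)
    rw [ha, hb]
    simp only [orient, vadd_eq_add, Prod.fst_add, Prod.snd_add, Prod.smul_fst, Prod.smul_snd,
      smul_eq_mul]
    ring
  · intro h
    refine ⟨q - p, ?_⟩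
    have key : ∃ b : ℝ, r = b • (q - p) + p := by
      unfold orient at h
      -- Some coordinate of `q - p` is nonzero; the multiple is found by dividing by that
      -- coordinate.
      by_cases h1 : q.1 - p.1 = 0
      · have h2 : q.2 - p.2 ≠ 0 := by
          intro h2
          exact hpq (Prod.ext (by linarith) (by linarith))
        refine ⟨(r.2 - p.2) / (q.2 - p.2), Prod.ext ?_ ?_⟩
        · have h3 : r.1 - p.1 = 0 := by
            rw [h1] at h
            have : (q.2 - p.2) * (r.1 - p.1) = 0 := by linarith
            exact (mul_eq_zero.1 this).resolve_left h2
          simp [h1]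
          linarith
        · simp
          field_simp
          ring
      · refine ⟨(r.1 - p.1) / (q.1 - p.1), Prod.ext ?_ ?_⟩
        · simp
          field_simp
          ring
        · simp
          field_simp
          linarith
    obtain ⟨b, hb⟩ := key
    intro x hx
    simp only [Set.mem_insert_iff, Set.mem_singleton_iff] at hx
    rcases hx with rfl | rfl | rfl
    · exact ⟨0, by simp⟩
    · exact ⟨1, by simp⟩
    · exact ⟨b, by simpa using hb⟩

/-- If two open segments have a common point, the ends of one lie on different sides of the other. -/
theorem orient_mul_neg_of_mem_openSegment {p q r s x : ℝ × ℝ} (hx : x ∈ openSegment ℝ p q)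
    (hx' : x ∈ openSegment ℝ r s) (hr : orient p q r ≠ 0) :
    orient p q r * orient p q s < 0 := by
  obtain ⟨α, β, -, -, h, rfl⟩ := hx
  obtain ⟨γ, δ, hγ, hδ, h', e⟩ := hx'
  have h1 : orient p q (γ • r + δ • s) = 0 := by
    rw [e, orient_combination _ _ _ _ _ _ h, orient_self_left, orient_self_right]
    ring
  rw [orient_combination _ _ _ _ _ _ h'] at h1
  -- The orientation relative to `pq` is affine and vanishes at the common point, so its values at
  -- `r` and `s` have positive weights with sum zero.
  have h2 : δ * (orient p q r * orient p q s) = -(γ * orient p q r ^ 2) := by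
    linear_combination orient p q r * h1
  have h3 : 0 < γ * orient p q r ^ 2 := by positivity
  by_contra h4
  have := mul_nonneg hδ.le (not_lt.1 h4)
  linarith

/-- An affine function with opposite signs at the ends of a segment vanishes at an interior point.
Applied to both segments this gives two points, and Cramer's rule shows that they coincide. -/
theorem openSegment_inter_nonempty_iff {p q r s : ℝ × ℝ} (h1 : orient p q r ≠ 0)
    (h2 : orient r s p ≠ 0) :
    (openSegment ℝ p q ∩ openSegment ℝ r s).Nonempty ↔
      orient p q r * orient p q s < 0 ∧ orient r s p * orient r s q < 0 := by
  constructor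
  · rintro ⟨x, hx, hx'⟩
    exact ⟨orient_mul_neg_of_mem_openSegment hx hx' h1,
      orient_mul_neg_of_mem_openSegment hx' hx h2⟩
  · have coeff : ∀ a b : ℝ, a * b < 0 →
        0 < a / (a - b) ∧ 0 < -b / (a - b) ∧ -b / (a - b) + a / (a - b) = 1 := by
      intro a b hab
      have hne : a - b ≠ 0 := by
        intro h
        obtain rfl : a = b := by linarith
        nlinarith
      refine ⟨?_, ?_, by field_simp; ring⟩
      · rw [← mul_div_mul_right _ _ hne]
        apply div_pos <;> nlinarith [mul_self_pos.2 hne, sq_nonneg a]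
      · rw [← mul_div_mul_right _ _ hne]
        apply div_pos <;> nlinarith [mul_self_pos.2 hne, sq_nonneg b]
    rintro ⟨h3, h4⟩
    obtain ⟨c1, c2, c3⟩ := coeff _ _ h3
    obtain ⟨d1, d2, d3⟩ := coeff _ _ h4
    refine ⟨_, ⟨_, _, d2, d1, d3, rfl⟩, ⟨_, _, c2, c1, c3, ?_⟩⟩
    have n1 : orient p q r - orient p q s ≠ 0 := by
      intro h; rw [h] at c1; simp at c1
    have n2 : orient r s p - orient r s q ≠ 0 := by
      intro h; rw [h] at d1; simp at d1
    -- Up to sign, both denominators are the cross product of the two directions; this is what makes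
    -- the two points comparable.
    have e : orient r s p - orient r s q = orient p q s - orient p q r := by
      unfold orient; ring
    have e' : orient r s p - orient r s q = -(orient p q r - orient p q s) := by
      rw [e]; ring
    rw [e']
    ext
    · simp only [Prod.fst_add, Prod.smul_fst, smul_eq_mul]
      field_simp
      unfold orient
      ring
    · simp only [Prod.snd_add, Prod.smul_snd, smul_eq_mul]
      field_simp
      unfold orient
      ring

/-! ### Crossings of complete graphs through orientations -/

section Complete

variable {n : ℕ}

theorem Realization.orient_ne_zero {V : Type*} {G : SimpleGraph V} (A : Realization G) {a b c : V}
    (hab : a ≠ b) (hac : a ≠ c) (hbc : b ≠ c) : orient (A.pos a) (A.pos b) (A.pos c) ≠ 0 :=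
  fun h => A.not_collinear a b c hab hac hbc
    ((collinear_triple_iff (A.pos_injective.ne hab)).2 h)

/-- Four vertices are pairwise different. -/
def Distinct4 {V : Type*} (a b c d : V) : Prop :=
  a ≠ b ∧ c ≠ d ∧ a ≠ c ∧ a ≠ d ∧ b ≠ c ∧ b ≠ d

/-- Segments with a common end that are not on one line have no common interior point. -/
theorem openSegment_inter_empty {p q r : ℝ × ℝ} (h : orient p q r ≠ 0) :
    ¬ (openSegment ℝ p q ∩ openSegment ℝ p r).Nonempty := by
  rintro ⟨x, hx, hx'⟩
  rw [openSegment_symm] at hx'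
  have := orient_mul_neg_of_mem_openSegment hx hx' h
  rw [orient_self_left, mul_zero] at this
  exact this.false

/-- A shared end would put two noncollinear segments in the situation of `openSegment_inter_empty`.
The points are an arbitrary family because this is also needed while a realization is still being
constructed. -/
theorem distinct4_of_openSegment_inter {V : Type*} {pos : V → ℝ × ℝ}
    (hpos : ∀ a b c, a ≠ b → a ≠ c → b ≠ c → orient (pos a) (pos b) (pos c) ≠ 0)
    {a b c d : V} (hab : a ≠ b) (hcd : c ≠ d) (hne : s(a, b) ≠ s(c, d))
    (h : (openSegment ℝ (pos a) (pos b) ∩ openSegment ℝ (pos c) (pos d)).Nonempty) :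
    Distinct4 a b c d := by
  refine ⟨hab, hcd, ?_, ?_, ?_, ?_⟩ <;> rintro rfl
  · exact openSegment_inter_empty (hpos _ _ _ hab hcd fun h => hne (by rw [h])) h
  · rw [openSegment_symm ℝ (pos c)] at h
    exact openSegment_inter_empty
      (hpos _ _ _ hab hcd.symm fun h => hne (by rw [h, Sym2.eq_swap])) h
  · rw [openSegment_symm ℝ (pos a)] at h
    exact openSegment_inter_empty
      (hpos _ _ _ hab.symm hcd fun h => hne (by rw [h, Sym2.eq_swap])) h
  · rw [openSegment_symm ℝ (pos a), openSegment_symm ℝ (pos c)] at h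
    exact openSegment_inter_empty
      (hpos _ _ _ hab.symm hcd.symm fun h => hne (by rw [h])) h

theorem Realization.crosses_iff (A : KRealization n) (a b c d : Fin n) :
    A.Crosses a b c d ↔ Distinct4 a b c d ∧
      orient (A.pos a) (A.pos b) (A.pos c) * orient (A.pos a) (A.pos b) (A.pos d) < 0 ∧
      orient (A.pos c) (A.pos d) (A.pos a) * orient (A.pos c) (A.pos d) (A.pos b) < 0 := by
  unfold Crosses
  simp only [SimpleGraph.top_adj]
  constructor
  · rintro ⟨hab, hcd, hne, h⟩
    have hD : Distinct4 a b c d :=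
      distinct4_of_openSegment_inter (fun _ _ _ => A.orient_ne_zero) hab hcd hne h
    obtain ⟨-, -, hac, had, hbc, hbd⟩ := id hD
    exact ⟨hD, (openSegment_inter_nonempty_iff (A.orient_ne_zero hab hac hbc)
      (A.orient_ne_zero hcd hac.symm had.symm)).1 h⟩
  · rintro ⟨⟨hab, hcd, hac, had, hbc, hbd⟩, h⟩
    refine ⟨hab, hcd, ?_, (openSegment_inter_nonempty_iff (A.orient_ne_zero hab hac hbc)
      (A.orient_ne_zero hcd hac.symm had.symm)).2 h⟩
    intro h
    rcases Sym2.eq_iff.1 h with h | h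
    · exact hac h.1
    · exact had h.1

theorem Realization.crosses_swap_left {V : Type*} {G : SimpleGraph V} (A : Realization G)
    (a b c d : V) : A.Crosses b a c d ↔ A.Crosses a b c d := by
  unfold Crosses
  rw [G.adj_comm, Sym2.eq_swap, openSegment_symm]

theorem Realization.crosses_swap {V : Type*} {G : SimpleGraph V} (A : Realization G)
    (a b c d : V) : A.Crosses c d a b ↔ A.Crosses a b c d := by
  unfold Crosses
  rw [Set.inter_comm, ne_comm]
  tauto

theorem Realization.crosses_swap_right {V : Type*} {G : SimpleGraph V} (A : Realization G)
    (a b c d : V) : A.Crosses a b d c ↔ A.Crosses a b c d := by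
  rw [A.crosses_swap, A.crosses_swap_left, A.crosses_swap]

/-- An unordered pair of edges has eight representatives, and crossing is invariant under the swaps
that connect them. -/
theorem Realization.mem_crossingSet {V : Type*} {G : SimpleGraph V} (A : Realization G)
    (a b c d : V) : s(s(a, b), s(c, d)) ∈ A.crossingSet ↔ A.Crosses a b c d := by
  refine ⟨?_, fun h => ⟨a, b, c, d, h, rfl⟩⟩
  rintro ⟨a', b', c', d', h, e⟩
  have := A.crosses_swap_left
  have := A.crosses_swap_right
  have := A.crosses_swap
  simp only [Sym2.eq_iff] at e
  rcases e with ⟨⟨rfl, rfl⟩ | ⟨rfl, rfl⟩, ⟨rfl, rfl⟩ | ⟨rfl, rfl⟩⟩ |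
    ⟨⟨rfl, rfl⟩ | ⟨rfl, rfl⟩, ⟨rfl, rfl⟩ | ⟨rfl, rfl⟩⟩ <;> simp_all

/-- A statement about pairs of edges holds for all pairs if it holds for pairs of disjoint edges on
four vertices in increasing order. -/
theorem forall_of_sorted {Q : Fin n → Fin n → Fin n → Fin n → Prop}
    (hl : ∀ a b c d, Q a b c d → Q b a c d) (hs : ∀ a b c d, Q a b c d → Q c d a b)
    (hdeg : ∀ a b c d, ¬ Distinct4 a b c d → Q a b c d)
    (hQ : ∀ a b c d, a < b → b < c → c < d → Q a b c d ∧ Q a c b d ∧ Q a d b c)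
    (a b c d : Fin n) : Q a b c d := by
  have hr : ∀ a b c d, Q a b c d → Q a b d c := fun a b c d h =>
    hs _ _ _ _ (hl _ _ _ _ (hs _ _ _ _ h))
  -- With `a` smallest, the position of `b` relative to `c < d` selects one of the three pairings of
  -- the sorted quadruple.
  have key : ∀ a b c d, a < b → c < d → a < c → Q a b c d := by
    intro a b c d hab hcd hac
    by_cases hD : Distinct4 a b c d
    · obtain ⟨-, -, -, -, hbc, hbd⟩ := hD
      rcases lt_or_gt_of_ne hbc with h | h
      · exact (hQ a b c d hab h hcd).1
      · rcases lt_or_gt_of_ne hbd with h' | h'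
        · exact (hQ a c b d hac h h').2.1
        · exact (hQ a c d b hac hcd h').2.2
    · exact hdeg _ _ _ _ hD
  have key2 : ∀ a b c d, a < b → c < d → Q a b c d := by
    intro a b c d hab hcd
    rcases lt_trichotomy a c with h | h | h
    · exact key _ _ _ _ hab hcd h
    · exact hdeg _ _ _ _ fun hD => hD.2.2.1 h
    · exact hs _ _ _ _ (key _ _ _ _ hcd hab h)
  have key3 : ∀ a b c d, a < b → Q a b c d := by
    intro a b c d hab
    rcases lt_trichotomy c d with h | h | h
    · exact key2 _ _ _ _ hab h
    · exact hdeg _ _ _ _ fun hD => hD.2.1 h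
    · exact hr _ _ _ _ (key2 _ _ _ _ hab h)
  rcases lt_trichotomy a b with h | h | h
  · exact key3 _ _ _ _ h
  · exact hdeg _ _ _ _ fun hD => hD.1 h
  · exact hl _ _ _ _ (key3 _ _ _ _ h)

end Complete

variable {n : ℕ}

theorem Realization.crosses_iff_of_distinct (A : KRealization n) {a b c d : Fin n}
    (h : Distinct4 a b c d) :
    A.Crosses a b c d ↔
      ¬ (0 < orient (A.pos a) (A.pos b) (A.pos c) ↔ 0 < orient (A.pos a) (A.pos b) (A.pos d)) ∧
      ¬ (0 < orient (A.pos c) (A.pos d) (A.pos a) ↔ 0 < orient (A.pos c) (A.pos d) (A.pos b)) := by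
  have key : ∀ x y : ℝ, x ≠ 0 → y ≠ 0 → (x * y < 0 ↔ ¬ (0 < x ↔ 0 < y)) := by
    intro x y hx hy
    rcases lt_or_gt_of_ne hx with hx | hx <;> rcases lt_or_gt_of_ne hy with hy | hy <;>
      simp [mul_neg_iff, hx, hy, not_lt_of_gt]
  obtain ⟨hab, hcd, hac, had, hbc, hbd⟩ := id h
  rw [A.crosses_iff, key _ _ (A.orient_ne_zero hab hac hbc) (A.orient_ne_zero hab had hbd),
    key _ _ (A.orient_ne_zero hcd hac.symm had.symm) (A.orient_ne_zero hcd hbc.symm hbd.symm)]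
  exact and_iff_right h

/-! ### Boolean descriptions of crossing sets -/

/-- A pair of edges without common ends. -/
def disjointPair {V : Type*} [DecidableEq V] : Sym2 (Sym2 V) → Bool :=
  Sym2.lift ⟨fun e f => Sym2.lift₂ ⟨fun a b c d =>
        decide (a ≠ b ∧ c ≠ d ∧ a ≠ c ∧ a ≠ d ∧ b ≠ c ∧ b ≠ d),
      fun a b c d => by
        simp only [decide_eq_decide, ne_comm (a := b) (b := a), ne_comm (a := d) (b := c)]
        tauto⟩ e f, fun e f => by
    induction e using Sym2.ind with | _ a b =>
    induction f using Sym2.ind with | _ c d =>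
    simp only [Sym2.lift₂_mk, decide_eq_decide, ne_comm (a := c), ne_comm (a := d) (b := a),
      ne_comm (a := d) (b := b)]
    tauto⟩

theorem disjointPair_iff {V : Type*} [DecidableEq V] {a b c d : V} :
    disjointPair s(s(a, b), s(c, d)) = true ↔ Distinct4 a b c d := by
  simp only [disjointPair, Sym2.lift_mk, Sym2.lift₂_mk, decide_eq_true_iff, Distinct4]

/-- `F` consists of pairs of disjoint edges, and `m` decides which pairs of disjoint edges belong to
`F`. -/
def Represents (m : Sym2 (Sym2 (Fin n)) → Bool) (F : Finset (Sym2 (Sym2 (Fin n)))) : Prop :=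
  (∀ x ∈ F, disjointPair x = true) ∧ ∀ x, disjointPair x = true → (m x = true ↔ x ∈ F)

theorem represents_decide {F : Finset (Sym2 (Sym2 (Fin n)))}
    (hF : ∀ x ∈ F, disjointPair x = true) : Represents (fun x => decide (x ∈ F)) F :=
  ⟨hF, fun _ _ => decide_eq_true_iff⟩

/-- The crossings described by `m`, relabelled by `π`, are those that belong to the orientations `s`
of the triples in increasing order. -/
def SignsMatch (s : Fin n → Fin n → Fin n → Bool) (π : Fin n → Fin n)
    (m : Sym2 (Sym2 (Fin n)) → Bool) : Prop :=
  ∀ a b, a < b → ∀ c, b < c → ∀ d, c < d →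
    (s a b c != s a b d && s a c d != s b c d) = m s(s(π a, π b), s(π c, π d)) ∧
    (s a b c == s a c d && s a b d == s b c d) = m s(s(π a, π c), s(π b, π d)) ∧
    (s a b d != s a c d && s a b c != s b c d) = m s(s(π a, π d), s(π b, π c))

instance (s : Fin n → Fin n → Fin n → Bool) (π : Fin n → Fin n)
    (m : Sym2 (Sym2 (Fin n)) → Bool) : Decidable (SignsMatch s π m) := by
  unfold SignsMatch; infer_instance

/-- `s` gives the orientations of the triples in increasing order. -/
def HasSigns (pos : Fin n → ℝ × ℝ) (s : Fin n → Fin n → Fin n → Bool) : Prop :=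
  ∀ a b c, a < b → b < c → (s a b c = true ↔ 0 < orient (pos a) (pos b) (pos c))

/-- The bridge from Boolean checks to geometry. Here `σ` lists the vertices in the order to which
the signs refer, and `π` gives the same positions their labels in `F`. With both equal to `id` it
computes the crossings of given points; with a radial order as `σ` it identifies an unknown
realization. -/
theorem Realization.crosses_iff_mem (A : KRealization n) {σ π : Fin n → Fin n}
    (hσ : Function.Injective σ) (hπ : Function.Injective π) {s : Fin n → Fin n → Fin n → Bool}
    {F : Finset (Sym2 (Sym2 (Fin n)))} {m : Sym2 (Sym2 (Fin n)) → Bool} (hF : Represents m F)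
    (hs : HasSigns (A.pos ∘ σ) s) (hm : SignsMatch s π m) (a b c d : Fin n) :
    A.Crosses (σ a) (σ b) (σ c) (σ d) ↔ s(s(π a, π b), s(π c, π d)) ∈ F := by
  have hinj : ∀ {f : Fin n → Fin n}, Function.Injective f → ∀ a b c d : Fin n,
      Distinct4 (f a) (f b) (f c) (f d) ↔ Distinct4 a b c d := by
    intro f hf a b c d
    simp only [Distinct4, hf.ne_iff]
  refine forall_of_sorted
    (Q := fun a b c d => A.Crosses (σ a) (σ b) (σ c) (σ d) ↔ s(s(π a, π b), s(π c, π d)) ∈ F)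
    ?_ ?_ ?_ ?_ a b c d
  · intro a b c d h
    rw [A.crosses_swap_left, h, Sym2.eq_swap (a := π a)]
  · intro a b c d h
    rw [A.crosses_swap, h, Sym2.eq_swap (a := s(π a, π b))]
  · intro a b c d h
    refine iff_of_false (fun h' => ?_) fun h' => ?_
    · rw [A.crosses_iff, hinj hσ] at h'
      exact h h'.1
    · exact h ((hinj hπ _ _ _ _).1 (disjointPair_iff.1 (hF.1 _ h')))
  · intro a b c d hab hbc hcd
    obtain ⟨h1, h2, h3⟩ := hm a b hab c hbc d hcd
    have hac := hab.trans hbc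
    have hbd := hbc.trans hcd
    have had := hac.trans hcd
    have p := hs a b c hab hbc
    have q := hs a b d hab hbd
    have r := hs a c d hac hcd
    have t := hs b c d hbc hcd
    have nz : ∀ x y z : Fin n, x < y → y < z →
        orient (A.pos (σ x)) (A.pos (σ y)) (A.pos (σ z)) ≠ 0 := fun x y z h h' =>
      A.orient_ne_zero (hσ.ne h.ne) (hσ.ne (h.trans h').ne) (hσ.ne h'.ne)
    have mem : ∀ {a b c d : Fin n}, Distinct4 a b c d →
        (s(s(π a, π b), s(π c, π d)) ∈ F ↔ m s(s(π a, π b), s(π c, π d)) = true) := fun h =>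
      (hF.2 _ (disjointPair_iff.2 ((hinj hπ _ _ _ _).2 h))).symm
    have flip : ∀ x : ℝ, x ≠ 0 → (0 < -x ↔ ¬ 0 < x) := by
      intro x hx
      rw [neg_pos, not_lt]
      exact ⟨le_of_lt, fun h => lt_of_le_of_ne h hx⟩
    simp only [Function.comp] at p q r t
    -- In each pairing, rotations and transpositions bring the four orientations to increasing
    -- order. Transpositions flip signs, which is why `==` replaces `!=` for the alternating
    -- pairing.
    refine ⟨?_, ?_, ?_⟩
    · have hD : Distinct4 _ _ _ _ := ⟨hab.ne, hcd.ne, hac.ne, had.ne, hbc.ne, hbd.ne⟩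
      rw [A.crosses_iff_of_distinct ((hinj hσ _ _ _ _).2 hD), mem hD,
        orient_rotate (A.pos (σ a)), orient_rotate (A.pos (σ b)), ← p, ← q, ← r, ← t, ← h1]
      generalize s a b c = p, s a b d = q, s a c d = r, s b c d = t
      revert p q r t; decide
    · have hD : Distinct4 _ _ _ _ := ⟨hac.ne, hbd.ne, hab.ne, had.ne, hbc.ne', hcd.ne⟩
      rw [A.crosses_iff_of_distinct ((hinj hσ _ _ _ _).2 hD), mem hD,
        orient_swap_right (A.pos (σ a)), orient_rotate (A.pos (σ a)),
        orient_swap_right (A.pos (σ b)), flip _ (nz _ _ _ hab hbc), flip _ (nz _ _ _ hbc hcd),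
        ← p, ← q, ← r, ← t, ← h2]
      generalize s a b c = p, s a b d = q, s a c d = r, s b c d = t
      revert p q r t; decide
    · have hD : Distinct4 _ _ _ _ := ⟨had.ne, hbc.ne, hab.ne, hac.ne, hbd.ne', hcd.ne'⟩
      rw [A.crosses_iff_of_distinct ((hinj hσ _ _ _ _).2 hD), mem hD,
        orient_swap_right (A.pos (σ a)) (A.pos (σ b)), orient_rotate (A.pos (σ a)),
        orient_swap_right (A.pos (σ a)) (A.pos (σ c)),
        flip _ (nz _ _ _ hab hbd), flip _ (nz _ _ _ hac hcd),
        ← p, ← q, ← r, ← t, ← h3]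
      generalize s a b c = p, s a b d = q, s a c d = r, s b c d = t
      revert p q r t; decide

/-- Realizations of a complete graph are isomorphic if their crossings correspond. -/
theorem Realization.equiv_of_crosses_iff {A B : KRealization n} {σ π : Fin n → Fin n}
    (hσ : Function.Bijective σ) (hπ : Function.Bijective π)
    (h : ∀ a b c d, A.Crosses (σ a) (σ b) (σ c) (σ d) ↔ B.Crosses (π a) (π b) (π c) (π d)) :
    A ≈ B := by
  let e := Equiv.ofBijective σ hσ
  have he : ∀ x, σ (e.symm x) = x := fun x => e.apply_symm_apply x
  have hb : Function.Bijective (π ∘ e.symm) := hπ.comp e.symm.bijective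
  refine ⟨π ∘ e.symm, hb, fun u v => ?_, fun x y u v => ?_⟩
  · simp only [SimpleGraph.top_adj, hb.injective.ne_iff]
  · simpa only [he, Function.comp] using h (e.symm x) (e.symm y) (e.symm u) (e.symm v)

theorem Realization.equiv_of_signsMatch {A B : KRealization n} {σ π : Fin n → Fin n}
    (hσ : Function.Injective σ) (hπ : Function.Injective π) {s : Fin n → Fin n → Fin n → Bool}
    {F : Finset (Sym2 (Sym2 (Fin n)))} {m : Sym2 (Sym2 (Fin n)) → Bool} (hF : Represents m F)
    (hB : B.crossingSet = F) (hs : HasSigns (A.pos ∘ σ) s) (hm : SignsMatch s π m) : A ≈ B := by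
  refine equiv_of_crosses_iff (Finite.injective_iff_bijective.1 hσ)
    (Finite.injective_iff_bijective.1 hπ) fun a b c d => ?_
  rw [A.crosses_iff_mem hσ hπ hF hs hm, ← B.mem_crossingSet, hB, Finset.mem_coe]

/-! ### Radial order around an extreme vertex -/

/-- Some functional `(x, y) ↦ x + t y` separates finitely many points of the plane. -/
theorem exists_shear_injective {V : Type*} [Finite V] {pos : V → ℝ × ℝ}
    (hpos : Function.Injective pos) :
    ∃ t : ℝ, Function.Injective fun v => (pos v).1 + t * (pos v).2 := by
  -- Each pair with different ordinates excludes a single `t`. Pairs with equal ordinates only add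
  -- the quotient by zero, which is harmless.
  have hfin : (Set.range fun p : V × V =>
      -((pos p.1).1 - (pos p.2).1) / ((pos p.1).2 - (pos p.2).2)).Finite := Set.finite_range _
  obtain ⟨t, ht⟩ := hfin.infinite_compl.nonempty
  refine ⟨t, fun u v huv => ?_⟩
  by_contra hne
  simp only at huv
  by_cases h2 : (pos u).2 - (pos v).2 = 0
  · have h2' : (pos u).2 = (pos v).2 := by linarith
    rw [h2'] at huv
    exact hne (hpos (Prod.ext (by linarith) h2'))
  · refine ht ⟨(u, v), ?_⟩
    simp only
    rw [div_eq_iff h2]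
    linarith

/-- The vertices of a realization can be ordered so that the first one is extreme and the others
are in counterclockwise order around it. -/
theorem Realization.exists_radial_order (A : KRealization (n + 1)) :
    ∃ σ : Equiv.Perm (Fin (n + 1)), ∀ i j, 0 < i → i < j →
      0 < orient (A.pos (σ 0)) (A.pos (σ i)) (A.pos (σ j)) := by
  obtain ⟨t, ht⟩ := exists_shear_injective A.pos_injective
  obtain ⟨m, hm⟩ := Finite.exists_min fun v => (A.pos v).1 + t * (A.pos v).2
  let u : Fin (n + 1) → ℝ := fun v =>
    (A.pos v).1 + t * (A.pos v).2 - ((A.pos m).1 + t * (A.pos m).2)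
  have hu : ∀ v, v ≠ m → 0 < u v := fun v hv =>
    sub_pos.2 (lt_of_le_of_ne (hm v) fun h => hv (ht h).symm)
  -- Seen from `m`, all other vertices lie in the open half-plane `u > 0`, where counterclockwise
  -- order is order by slope; `⊥` makes `m` come first.
  let f : Fin (n + 1) → WithBot ℝ := fun v =>
    if v = m then ⊥ else (((A.pos v).2 - (A.pos m).2) / u v : ℝ)
  have hmono : Monotone (f ∘ Tuple.sort f) := Tuple.monotone_sort f
  have hf : ∀ v, f v = ⊥ → v = m := by
    intro v hv
    by_contra h
    simp [f, h] at hv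
  have h0 : Tuple.sort f 0 = m := by
    apply hf
    have h := hmono (Fin.zero_le ((Tuple.sort f).symm m))
    simp only [Function.comp, Equiv.apply_symm_apply] at h
    rw [show f m = ⊥ by simp [f]] at h
    exact le_bot_iff.1 h
  refine ⟨Tuple.sort f, fun i j hi hij => ?_⟩
  have hne : ∀ k, 0 < k → Tuple.sort f k ≠ m := fun k hk h =>
    hk.ne' ((Tuple.sort f).injective (h.trans h0.symm))
  have hj := hi.trans hij
  have hle := hmono hij.le
  simp only [Function.comp, f, hne i hi, hne j hj, if_false, WithBot.coe_le_coe] at hle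
  -- After clearing denominators the terms with `t` cancel: a shear preserves signed areas.
  rw [div_le_div_iff₀ (hu _ (hne i hi)) (hu _ (hne j hj))] at hle
  rw [h0]
  refine lt_of_le_of_ne ?_ (A.orient_ne_zero (hne i hi).symm (hne j hj).symm
    ((Tuple.sort f).injective.ne hij.ne)).symm
  simp only [u] at hle
  unfold orient
  linarith

/-! ### Sign words and Grassmann-Plücker relations -/

/-- The orientations of the triples `a < b < c`, encoded by a natural number `w`: those that contain
`0` are positive, the bits of `w` give the others in colexicographic order. -/
def wordSign (w a b c : ℕ) : Bool :=
  a == 0 || w.testBit ((c - 1) * (c - 2) * (c - 3) / 6 + (b - 1) * (b - 2) / 2 + (a - 1))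

/-- The signs allow `x₀ x₁ - x₂ x₃ + x₄ x₅ = 0`. -/
def relationSigns (x₀ x₁ x₂ x₃ x₄ x₅ : Bool) : Bool :=
  ((x₀ == x₁) == (x₂ == x₃)) || ((x₀ == x₁) != (x₄ == x₅))

/-- Three nonzero reals with sum zero do not all have the same sign. -/
theorem relationSigns_of_eq {x₀ x₁ x₂ x₃ x₄ x₅ : ℝ} {s₀ s₁ s₂ s₃ s₄ s₅ : Bool}
    (h₀ : s₀ = true ↔ 0 < x₀) (h₁ : s₁ = true ↔ 0 < x₁) (h₂ : s₂ = true ↔ 0 < x₂)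
    (h₃ : s₃ = true ↔ 0 < x₃) (h₄ : s₄ = true ↔ 0 < x₄) (h₅ : s₅ = true ↔ 0 < x₅)
    (n₀ : x₀ ≠ 0) (n₁ : x₁ ≠ 0) (n₂ : x₂ ≠ 0) (n₃ : x₃ ≠ 0) (n₄ : x₄ ≠ 0) (n₅ : x₅ ≠ 0)
    (h : x₀ * x₁ - x₂ * x₃ + x₄ * x₅ = 0) : relationSigns s₀ s₁ s₂ s₃ s₄ s₅ = true := by
  have key : ∀ {x y : ℝ} {s t : Bool}, (s = true ↔ 0 < x) → (t = true ↔ 0 < y) → x ≠ 0 → y ≠ 0 →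
      ((s == t) = true ∧ 0 < x * y ∨ (s == t) = false ∧ x * y < 0) := by
    intro x y s t hs ht hx hy
    rcases lt_or_gt_of_ne hx with hx | hx <;> rcases lt_or_gt_of_ne hy with hy | hy
    · have h1 : s = false := by simpa [not_lt_of_gt hx] using hs
      have h2 : t = false := by simpa [not_lt_of_gt hy] using ht
      exact Or.inl ⟨by simp [h1, h2], mul_pos_of_neg_of_neg hx hy⟩
    · have h1 : s = false := by simpa [not_lt_of_gt hx] using hs
      exact Or.inr ⟨by simp [h1, ht.2 hy], mul_neg_of_neg_of_pos hx hy⟩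
    · have h2 : t = false := by simpa [not_lt_of_gt hy] using ht
      exact Or.inr ⟨by simp [hs.2 hx, h2], mul_neg_of_pos_of_neg hx hy⟩
    · exact Or.inl ⟨by simp [hs.2 hx, ht.2 hy], mul_pos hx hy⟩
  unfold relationSigns
  rcases key h₀ h₁ n₀ n₁ with ⟨e, k⟩ | ⟨e, k⟩ <;> rcases key h₂ h₃ n₂ n₃ with ⟨e', k'⟩ | ⟨e', k'⟩ <;>
    rcases key h₄ h₅ n₄ n₅ with ⟨e'', k''⟩ | ⟨e'', k''⟩ <;> rw [e, e', e''] <;>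
    first | rfl | (exfalso; linarith)

/-- The Grassmann-Plücker relations for the five points `a < b < c < d < e` do not contradict the
orientations `w`. -/
def WordConsistent (n w : ℕ) : Prop :=
  ∀ e < n, ∀ d < e, ∀ c < d, ∀ b < c, ∀ a < b,
    relationSigns (wordSign w a b c) (wordSign w b d e) (wordSign w a b d) (wordSign w b c e)
      (wordSign w a b e) (wordSign w b c d) = true ∧
    relationSigns (wordSign w a b c) (wordSign w c d e) (wordSign w a c d) (wordSign w b c e)
      (wordSign w a c e) (wordSign w b c d) = true ∧
    relationSigns (wordSign w a b d) (wordSign w c d e) (wordSign w a c d) (wordSign w b d e)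
      (wordSign w a d e) (wordSign w b c d) = true

set_option synthInstance.maxSize 10000 in
set_option synthInstance.maxHeartbeats 200000 in
instance (n w : ℕ) : Decidable (WordConsistent n w) := by
  unfold WordConsistent; infer_instance

-- The colexicographic index numbers the triples of nonzero indices without repetition, so their
-- signs can be prescribed freely as bits.
set_option synthInstance.maxSize 10000 in
set_option synthInstance.maxHeartbeats 200000 in
theorem exists_word {n : ℕ} (hn : n ≤ 6) (s : ℕ → ℕ → ℕ → Bool) :
    ∃ w < 2 ^ (n - 1).choose 3, ∀ c < n, ∀ b < c, ∀ a < b, 0 < a → wordSign w a b c = s a b c := by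
  -- The inverse of the colexicographic numbering. Since `n ≤ 6` gives at most ten triples, the
  -- default is never used.
  let tr : ℕ → ℕ × ℕ × ℕ := fun k =>
    [(1, 2, 3), (1, 2, 4), (1, 3, 4), (2, 3, 4), (1, 2, 5), (1, 3, 5), (2, 3, 5), (1, 4, 5),
      (2, 4, 5), (3, 4, 5)].getD k 0
  have htr : ∀ n < 7, ∀ c < n, ∀ b < c, ∀ a < b, 0 < a →
      (c - 1) * (c - 2) * (c - 3) / 6 + (b - 1) * (b - 2) / 2 + (a - 1) < (n - 1).choose 3 ∧
      tr ((c - 1) * (c - 2) * (c - 3) / 6 + (b - 1) * (b - 2) / 2 + (a - 1)) = (a, b, c) := by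
    decide +kernel
  let bit : Fin ((n - 1).choose 3) → Bool := fun k => s (tr k).1 (tr k).2.1 (tr k).2.2
  refine ⟨Nat.ofBits bit, Nat.ofBits_lt_two_pow bit, fun c hc b hb a ha h0 => ?_⟩
  obtain ⟨h1, h2⟩ := htr n (by omega) c hc b hb a ha h0
  rw [wordSign, Nat.testBit_ofBits_lt _ _ h1]
  simp only [bit, h2]
  simp [h0.ne']

/-- Every realization of a complete graph on at most six vertices is described by a word. -/
theorem Realization.exists_word (A : KRealization n) (hn : n ≤ 6) :
    ∃ σ : Equiv.Perm (Fin n), ∃ w < 2 ^ (n - 1).choose 3, WordConsistent n w ∧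
      HasSigns (A.pos ∘ σ) fun a b c => wordSign w a b c := by
  obtain _ | m := n
  · exact ⟨1, 0, by simp, fun e he => absurd he (by omega), fun a => a.elim0⟩
  obtain ⟨σ, hσ⟩ := A.exists_radial_order
  let P : ℕ → ℝ × ℝ := fun a => if h : a < m + 1 then A.pos (σ ⟨a, h⟩) else 0
  have hP : ∀ a : Fin (m + 1), P a = A.pos (σ a) := fun a => dif_pos a.2
  obtain ⟨w, hw, hs⟩ := GeomGraph.exists_word hn fun a b c => decide (0 < orient (P a) (P b) (P c))
  have hs' : ∀ a b c, a < b → b < c → c < m + 1 →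
      (wordSign w a b c = true ↔ 0 < orient (P a) (P b) (P c)) := by
    intro a b c hab hbc hc
    rcases Nat.eq_zero_or_pos a with rfl | h0
    · refine iff_of_true (by simp [wordSign]) ?_
      have := hσ ⟨b, by omega⟩ ⟨c, hc⟩ (Fin.mk_lt_mk.2 hab) (Fin.mk_lt_mk.2 hbc)
      rw [← hP, ← hP, ← hP] at this
      exact this
    · rw [hs c hc b hbc a hab h0, decide_eq_true_iff]
  have nz : ∀ a b c, a < b → b < c → c < m + 1 → orient (P a) (P b) (P c) ≠ 0 := by
    intro a b c hab hbc hc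
    have := A.orient_ne_zero (a := σ ⟨a, by omega⟩) (b := σ ⟨b, by omega⟩) (c := σ ⟨c, hc⟩)
      (σ.injective.ne (by simp; omega)) (σ.injective.ne (by simp; omega))
      (σ.injective.ne (by simp; omega))
    rw [← hP, ← hP, ← hP] at this
    exact this
  refine ⟨σ, w, hw, fun e he d hd c hc b hb a ha => ⟨?_, ?_, ?_⟩, fun a b c hab hbc => ?_⟩
  -- The three identities are those in which `b`, `c` and `d`, respectively, is common to all six
  -- brackets.
  · apply relationSigns_of_eq (hs' a b c _ _ _) (hs' b d e _ _ _) (hs' a b d _ _ _)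
      (hs' b c e _ _ _) (hs' a b e _ _ _) (hs' b c d _ _ _) (nz a b c _ _ _) (nz b d e _ _ _)
      (nz a b d _ _ _) (nz b c e _ _ _) (nz a b e _ _ _) (nz b c d _ _ _) <;>
      first | omega | (unfold orient; ring)
  · apply relationSigns_of_eq (hs' a b c _ _ _) (hs' c d e _ _ _) (hs' a c d _ _ _)
      (hs' b c e _ _ _) (hs' a c e _ _ _) (hs' b c d _ _ _) (nz a b c _ _ _) (nz c d e _ _ _)
      (nz a c d _ _ _) (nz b c e _ _ _) (nz a c e _ _ _) (nz b c d _ _ _) <;>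
      first | omega | (unfold orient; ring)
  · apply relationSigns_of_eq (hs' a b d _ _ _) (hs' c d e _ _ _) (hs' a c d _ _ _)
      (hs' b d e _ _ _) (hs' a d e _ _ _) (hs' b c d _ _ _) (nz a b d _ _ _) (nz c d e _ _ _)
      (nz a c d _ _ _) (nz b d e _ _ _) (nz a d e _ _ _) (nz b c d _ _ _) <;>
      first | omega | (unfold orient; ring)
  · have := hs' a b c hab hbc c.2
    rw [hP, hP, hP] at this
    exact this

/-! ### Realizations from integer points -/

/-- Twice the signed area of a triangle with integer vertices. -/
def orientInt (p q r : ℤ × ℤ) : ℤ :=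
  (q.1 - p.1) * (r.2 - p.2) - (q.2 - p.2) * (r.1 - p.1)

/-- The determinant that vanishes if the lines `pq`, `rs`, `tu` have a common point. -/
def lineDet {R : Type*} [CommRing R] (p q r s t u : R × R) : R :=
  (p.1 * q.2 - p.2 * q.1) * ((r.2 - s.2) * (u.1 - t.1) - (s.1 - r.1) * (t.2 - u.2)) -
  (r.1 * s.2 - r.2 * s.1) * ((p.2 - q.2) * (u.1 - t.1) - (q.1 - p.1) * (t.2 - u.2)) +
  (t.1 * u.2 - t.2 * u.1) * ((p.2 - q.2) * (s.1 - r.1) - (q.1 - p.1) * (r.2 - s.2))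

/-- The vector `(x.1, x.2, 1)` is in the kernel of the matrix of line coefficients. The multipliers
below are the cofactors of its column of constant terms. -/
theorem lineDet_eq_zero {p q r s t u x : ℝ × ℝ} (h₁ : x ∈ openSegment ℝ p q)
    (h₂ : x ∈ openSegment ℝ r s) (h₃ : x ∈ openSegment ℝ t u) : lineDet p q r s t u = 0 := by
  have key : ∀ {p q : ℝ × ℝ}, x ∈ openSegment ℝ p q → orient p q x = 0 := by
    rintro p q ⟨α, β, -, -, h, rfl⟩
    rw [orient_combination _ _ _ _ _ _ h, orient_self_left, orient_self_right]
    ring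
  have e₁ := key h₁
  have e₂ := key h₂
  have e₃ := key h₃
  unfold orient at e₁ e₂ e₃
  unfold lineDet
  linear_combination ((r.2 - s.2) * (u.1 - t.1) - (s.1 - r.1) * (t.2 - u.2)) * e₁ -
    ((p.2 - q.2) * (u.1 - t.1) - (q.1 - p.1) * (t.2 - u.2)) * e₂ +
    ((p.2 - q.2) * (s.1 - r.1) - (q.1 - p.1) * (r.2 - s.2)) * e₃

theorem Distinct4.symm {V : Type*} {a b c d : V} (h : Distinct4 a b c d) : Distinct4 c d a b :=
  ⟨h.2.1, h.1, h.2.2.1.symm, h.2.2.2.2.1.symm, h.2.2.2.1.symm, h.2.2.2.2.2.symm⟩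

instance {V : Type*} [DecidableEq V] (a b c d : V) : Decidable (Distinct4 a b c d) := by
  unfold Distinct4; infer_instance

/-- Points with integer coordinates in general position. -/
def GeneralPosition (P : Fin n → ℤ × ℤ) : Prop :=
  (∀ a b, a < b → P a ≠ P b) ∧
  (∀ a b, a < b → ∀ c, b < c → orientInt (P a) (P b) (P c) ≠ 0) ∧
  ∀ a b, a < b → ∀ c, a < c → ∀ d, c < d → Distinct4 a b c d →
    ∀ e, c < e → ∀ f, e < f → Distinct4 a b e f → Distinct4 c d e f →
    lineDet (P a) (P b) (P c) (P d) (P e) (P f) ≠ 0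

set_option synthInstance.maxSize 10000 in
set_option synthInstance.maxHeartbeats 200000 in
instance (P : Fin n → ℤ × ℤ) : Decidable (GeneralPosition P) := by
  unfold GeneralPosition; infer_instance

/-- Integer points in general position give a realization, whose crossings can be computed. -/
theorem exists_realization {P : Fin n → ℤ × ℤ} {F : Finset (Sym2 (Sym2 (Fin n)))}
    {m : Sym2 (Sym2 (Fin n)) → Bool} (hP : GeneralPosition P) (hF : Represents m F)
    (hm : SignsMatch (fun a b c => decide (0 < orientInt (P a) (P b) (P c))) id m) :
    ∃ A : KRealization n, A.crossingSet = F := by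
  obtain ⟨h2, h3, h6⟩ := hP
  let pos : Fin n → ℝ × ℝ := fun v => ((P v).1, (P v).2)
  have hor : ∀ a b c, orient (pos a) (pos b) (pos c) = (orientInt (P a) (P b) (P c) : ℤ) := by
    intro a b c
    simp only [orient, orientInt, pos]
    push_cast
    ring
  have hdet : ∀ a b c d e f, lineDet (pos a) (pos b) (pos c) (pos d) (pos e) (pos f) =
      (lineDet (P a) (P b) (P c) (P d) (P e) (P f) : ℤ) := by
    intro a b c d e f
    simp only [lineDet, pos]
    push_cast
    ring
  have hinj : Function.Injective pos := by
    intro a b hab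
    have e : P a = P b := by
      simp only [pos, Prod.mk.injEq, Int.cast_inj] at hab
      exact Prod.ext hab.1 hab.2
    rcases lt_trichotomy a b with h | h | h
    · exact absurd e (h2 a b h)
    · exact h
    · exact absurd e.symm (h2 b a h)
  have h3' : ∀ a b c, a < b → b < c → orient (pos a) (pos b) (pos c) ≠ 0 := by
    intro a b c hab hbc
    rw [hor]
    exact_mod_cast h3 a b hab c hbc
  have hne : ∀ a b c, a ≠ b → a ≠ c → b ≠ c → orient (pos a) (pos b) (pos c) ≠ 0 := by
    have key : ∀ a b c, a < b → a ≠ c → b ≠ c → orient (pos a) (pos b) (pos c) ≠ 0 := by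
      intro a b c hab hac hbc
      rcases lt_or_gt_of_ne hac with h | h
      · rcases lt_or_gt_of_ne hbc with h' | h'
        · exact h3' _ _ _ hab h'
        · rw [← neg_ne_zero, ← orient_swap_right]
          exact h3' _ _ _ h h'
      · rw [orient_rotate (pos c)]
        exact h3' _ _ _ h hab
    intro a b c hab hac hbc
    rcases lt_or_gt_of_ne hab with h | h
    · exact key _ _ _ h hac hbc
    · rw [← neg_ne_zero, ← orient_swap_left]
      exact key _ _ _ h hbc hac
  have h6' : ∀ (a b c d e f : Fin n) {x : ℝ × ℝ}, a < b → c < d → e < f → a < c → c < e →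
      Distinct4 a b c d → Distinct4 a b e f → Distinct4 c d e f →
      x ∈ openSegment ℝ (pos a) (pos b) → x ∈ openSegment ℝ (pos c) (pos d) →
      x ∈ openSegment ℝ (pos e) (pos f) → False := by
    intro a b c d e f x hab hcd hef hac hce D1 D2 D3 k1 k2 k3
    have := lineDet_eq_zero k1 k2 k3
    rw [hdet] at this
    exact h6 a b hab c hac d hcd D1 e hce f hef D2 D3 (by exact_mod_cast this)
  let A : KRealization n :=
    { pos := pos
      pos_injective := hinj
      not_collinear := fun a b c hab hac hbc h =>
        hne a b c hab hac hbc ((collinear_triple_iff (hinj.ne hab)).1 h)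
      not_concurrent := by
        rintro a b c d e f hab hcd hef n1 n2 n3 ⟨x, ⟨hx, hx'⟩, hx''⟩
        simp only [SimpleGraph.top_adj] at hab hcd hef
        have sorted : ∀ a b : Fin n, a ≠ b → x ∈ openSegment ℝ (pos a) (pos b) →
            ∃ a' b', a' < b' ∧ s(a, b) = s(a', b') ∧ x ∈ openSegment ℝ (pos a') (pos b') := by
          intro a b hab h
          rcases lt_or_gt_of_ne hab with h' | h'
          · exact ⟨a, b, h', rfl, h⟩
          · exact ⟨b, a, h', Sym2.eq_swap, by rwa [openSegment_symm]⟩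
        obtain ⟨a', b', hab', e1, k1⟩ := sorted a b hab hx
        obtain ⟨c', d', hcd', e2, k2⟩ := sorted c d hcd hx'
        obtain ⟨e', f', hef', e3, k3⟩ := sorted e f hef hx''
        rw [e1, e2] at n1
        rw [e1, e3] at n2
        rw [e2, e3] at n3
        -- Edges through one interior point are pairwise disjoint, so a determinant is needed only
        -- for triples of disjoint edges, sorted by their smaller ends. Of the eight comparison
        -- patterns below, two are cyclic and impossible.
        have D1 := distinct4_of_openSegment_inter hne hab'.ne hcd'.ne n1 ⟨x, k1, k2⟩
        have D2 := distinct4_of_openSegment_inter hne hab'.ne hef'.ne n2 ⟨x, k1, k3⟩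
        have D3 := distinct4_of_openSegment_inter hne hcd'.ne hef'.ne n3 ⟨x, k2, k3⟩
        rcases lt_or_gt_of_ne D1.2.2.1 with l1 | l1 <;>
          rcases lt_or_gt_of_ne D2.2.2.1 with l2 | l2 <;>
          rcases lt_or_gt_of_ne D3.2.2.1 with l3 | l3
        · exact h6' _ _ _ _ _ _ hab' hcd' hef' l1 l3 D1 D2 D3 k1 k2 k3
        · exact h6' _ _ _ _ _ _ hab' hef' hcd' l2 l3 D2 D1 D3.symm k1 k3 k2
        · exact absurd (l1.trans l3) l2.not_gt
        · exact h6' _ _ _ _ _ _ hef' hab' hcd' l2 l1 D2.symm D3.symm D1 k3 k1 k2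
        · exact h6' _ _ _ _ _ _ hcd' hab' hef' l1 l2 D1.symm D3 D2 k2 k1 k3
        · exact absurd (l1.trans l2) l3.not_gt
        · exact h6' _ _ _ _ _ _ hcd' hef' hab' l3 l2 D3 D1.symm D2.symm k2 k3 k1
        · exact h6' _ _ _ _ _ _ hef' hcd' hab' l3 l1 D3.symm D2.symm D1.symm k3 k2 k1 }
  have hA : ∀ a b c d, A.Crosses a b c d ↔ s(s(a, b), s(c, d)) ∈ F :=
    A.crosses_iff_mem (σ := id) Function.injective_id Function.injective_id hF
      (fun a b c _ _ => by
        rw [decide_eq_true_iff]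
        simp only [Function.comp, id, A, hor, Int.cast_pos]) hm
  refine ⟨A, Set.ext fun x => ?_⟩
  induction x using Sym2.ind with | _ e f =>
  induction e using Sym2.ind with | _ a b =>
  induction f using Sym2.ind with | _ c d =>
  rw [A.mem_crossingSet, hA, Finset.mem_coe]

/-! ### Classification by tables -/

/-- If the consistent words occur in a table that maps each of them to one of the crossing sets of
the realizations `R`, then every realization is isomorphic to one of them. -/
theorem surjective_toClass_of_table {ι : Type*} {R : ι → KRealization n}
    {F : ι → Finset (Sym2 (Sym2 (Fin n)))} (hR : ∀ i, (R i).crossingSet = F i)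
    {m : ι → Sym2 (Sym2 (Fin n)) → Bool} (hF : ∀ i, Represents (m i) (F i)) (hn : n ≤ 6)
    (table : List (ℕ × ι × (Fin n → Fin n)))
    (hw : ∀ w < 2 ^ (n - 1).choose 3, WordConsistent n w → w ∈ table.map Prod.fst)
    (ht : ∀ x ∈ table, Function.Injective x.2.2 ∧
      SignsMatch (fun a b c => wordSign x.1 a b c) x.2.2 (m x.2.1)) :
    Function.Surjective fun i => (R i).toClass := by
  rintro ⟨A⟩
  obtain ⟨σ, w, hlt, hc, hs⟩ := A.exists_word hn
  obtain ⟨⟨w', i, π⟩, hx, rfl⟩ := List.mem_map.1 (hw w hlt hc)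
  obtain ⟨hπ, hm⟩ := ht _ hx
  exact ⟨i, Quotient.sound
    (Setoid.symm (Realization.equiv_of_signsMatch σ.injective hπ (hF i) (hR i) hs hm))⟩

/-! ### The order on crossing sets -/

/-- The relation `≼` in terms of the crossing sets. -/
theorem Realization.precedes_iff {A B : KRealization n} {F G : Finset (Sym2 (Sym2 (Fin n)))}
    (hA : A.crossingSet = F) (hB : B.crossingSet = G) :
    A.Precedes B ↔ ∃ f : Fin n → Fin n, Function.Injective f ∧
      ∀ x ∈ F, x.map (Sym2.map f) ∈ G := by
  constructor
  · rintro ⟨f, hf, h⟩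
    refine ⟨f, hf, fun x hx => ?_⟩
    rw [← Finset.mem_coe, ← hA] at hx
    obtain ⟨a, b, c, d, hx, rfl⟩ := hx
    rw [← Finset.mem_coe, ← hB]
    exact (B.mem_crossingSet _ _ _ _).2 (h.map_crosses a b c d hx)
  · rintro ⟨f, hf, h⟩
    refine ⟨f, hf, fun u v huv => hf.ne huv, fun a b c d hx => ?_⟩
    rw [← A.mem_crossingSet, hA] at hx
    rw [← B.mem_crossingSet, hB]
    exact h _ hx

/-- An injective vertex map induces an injective map on pairs of edges. -/
theorem Realization.Precedes.card_le {A B : KRealization n} {F G : Finset (Sym2 (Sym2 (Fin n)))}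
    (hA : A.crossingSet = F) (hB : B.crossingSet = G) (h : A.Precedes B) : F.card ≤ G.card := by
  obtain ⟨f, hf, h⟩ := (precedes_iff hA hB).1 h
  exact Finset.card_le_card_of_injOn _ h (Sym2.map.injective (Sym2.map.injective hf)).injOn

theorem Realization.toClass_lt {A B : KRealization n} {F G : Finset (Sym2 (Sym2 (Fin n)))}
    (hA : A.crossingSet = F) (hB : B.crossingSet = G) (f : Fin n → Fin n)
    (hf : Function.Injective f) (h : ∀ x ∈ F, x.map (Sym2.map f) ∈ G) (hc : F.card < G.card) :
    A.toClass < B.toClass :=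
  lt_of_le_not_ge (Realization.toClass_le_iff.2 ((precedes_iff hA hB).2 ⟨f, hf, h⟩)) fun h' =>
    hc.not_ge ((Realization.toClass_le_iff.1 h').card_le hB hA)

/-! ### Numerical codes and enumeration of permutations -/

/-- A number that describes a pair of edges in terms of weights of the vertices. -/
def pairCode (w : Fin n → ℕ) : Sym2 (Sym2 (Fin n)) → ℕ :=
  Sym2.lift ⟨fun e f => Sym2.lift₂ ⟨fun a b c d => (w a + w b) * (w c + w d) % 89,
      fun a b c d => ⟨by beta_reduce; rw [add_comm (w a)],
        by beta_reduce; rw [add_comm (w c)]⟩⟩ e f, fun e f => by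
    induction e using Sym2.ind with | _ a b =>
    induction f using Sym2.ind with | _ c d =>
    simp only [Sym2.lift₂_mk, mul_comm]⟩

/-- Relabelling vertices amounts to rearranging the weights, so a search over vertex maps becomes a
search over arrangements of six numbers. -/
theorem pairCode_map (w : Fin n → ℕ) (f : Fin n → Fin n) (x : Sym2 (Sym2 (Fin n))) :
    pairCode w (x.map (Sym2.map f)) = pairCode (w ∘ f) x := by
  induction x using Sym2.ind with | _ e f =>
  induction e using Sym2.ind with | _ a b =>
  induction f using Sym2.ind with | _ c d =>
  rfl

/-- The function on `Fin 6` with the given values. -/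
def sixTuple (a b c d e f : ℕ) (k : Fin 6) : ℕ :=
  match k.val with
  | 0 => a
  | 1 => b
  | 2 => c
  | 3 => d
  | 4 => e
  | _ => f

/-- Weights of six vertices, for which `pairCode` distinguishes all pairs of disjoint edges. -/
def sixWeights : Fin 6 → ℕ :=
  sixTuple 1 2 6 10 13 16

/-- The Boolean function `p` is true at all six-tuples of different members of a list. -/
def allArrangements (l : List ℕ) (p : (Fin 6 → ℕ) → Bool) : Bool :=
  l.all fun a => l.all fun b => b == a || l.all fun c => c == a || c == b ||
  l.all fun d => d == a || d == b || d == c || l.all fun e => e == a || e == b || e == c || e == d ||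
  l.all fun f => f == a || f == b || f == c || f == d || f == e || p (sixTuple a b c d e f)

theorem allArrangements_apply {l : List ℕ} {p : (Fin 6 → ℕ) → Bool}
    (h : allArrangements l p = true) {w : Fin 6 → ℕ} (hw : Function.Injective w)
    (hl : ∀ i, w i ∈ l) : p w = true := by
  simp only [allArrangements, List.all_eq_true, Bool.or_eq_true, beq_iff_eq] at h
  have hne : ∀ i j : Fin 6, i ≠ j → w i ≠ w j := fun i j => hw.ne
  have e : sixTuple (w 0) (w 1) (w 2) (w 3) (w 4) (w 5) = w := by
    ext i; fin_cases i <;> rfl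
  have h1 := (h _ (hl 0) _ (hl 1)).resolve_left (hne _ _ (by decide))
  have h2 := (h1 _ (hl 2)).resolve_left (by simp [hw.eq_iff])
  have h3 := (h2 _ (hl 3)).resolve_left (by simp [hw.eq_iff])
  have h4 := (h3 _ (hl 4)).resolve_left (by simp [hw.eq_iff])
  have h5 := (h4 _ (hl 5)).resolve_left (by simp [hw.eq_iff])
  rwa [e] at h5

/-! ### Data for four, five and six vertices -/

/-- The crossings of the two realizations of the complete graph on four vertices. -/
def k4Crossings : Fin 2 → Finset (Sym2 (Sym2 (Fin 4))) :=
  ![∅, { s(s(1, 3), s(2, 4)) }]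

/-- Points that realize `k4Crossings`. -/
def k4Points : Fin 2 → Fin 4 → ℤ × ℤ :=
  ![![(2, 2), (1, 0), (0, 1), (1, 1)], ![(0, 0), (1, 0), (1, 1), (0, 1)]]

/-- The consistent words for four vertices; for each of them the crossing set and a relabelling. -/
def k4Table : List (ℕ × Fin 2 × (Fin 4 → Fin 4)) := [
  (0, 0, ![0, 1, 2, 3]),
  (1, 1, ![0, 1, 2, 3])]

/-- Points that realize `k5Crossings`. -/
def k5Points : Fin 3 → Fin 5 → ℤ × ℤ :=
  ![![(0, 3), (1, 0), (3, 3), (2, 2), (1, 2)], ![(2, 1), (1, 0), (1, 1), (0, 2), (2, 2)],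
    ![(2, 1), (1, 0), (0, 1), (0, 2), (2, 2)]]

/-- The consistent words for five vertices; for each of them the crossing set and a relabelling. -/
def k5Table : List (ℕ × Fin 3 × (Fin 5 → Fin 5)) := [
  (0, 0, ![1, 0, 2, 3, 4]),
  (1, 0, ![0, 2, 3, 4, 1]),
  (3, 1, ![1, 0, 4, 2, 3]),
  (7, 1, ![0, 4, 3, 2, 1]),
  (8, 0, ![0, 1, 2, 3, 4]),
  (12, 1, ![1, 3, 2, 4, 0]),
  (14, 1, ![0, 1, 2, 3, 4]),
  (15, 2, ![0, 1, 2, 3, 4])]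

/-- Points that realize `K6Name.crossings`. -/
def K6Name.points : K6Name → Fin 6 → ℤ × ℤ
  | .r3_1 => ![(5, 5), (5, 1), (6, 0), (6, 6), (0, 2), (1, 2)]
  | .r4_1 => ![(1, 2), (0, 0), (6, 1), (3, 2), (1, 5), (0, 6)]
  | .r5_1 => ![(1, 0), (8, 4), (7, 4), (3, 3), (2, 2), (0, 7)]
  | .r5_2 => ![(4, 1), (5, 2), (5, 6), (1, 1), (0, 0), (6, 0)]
  | .r6_1 => ![(2, 2), (5, 5), (2, 3), (0, 6), (1, 2), (1, 0)]
  | .r7_1 => ![(3, 2), (1, 1), (5, 0), (4, 2), (4, 4), (0, 3)]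
  | .r7_2 => ![(4, 0), (3, 2), (2, 3), (0, 3), (2, 5), (5, 5)]
  | .r8_1 => ![(4, 1), (3, 1), (0, 3), (5, 5), (5, 0), (4, 0)]
  | .r8_2 => ![(3, 0), (4, 0), (5, 3), (2, 4), (1, 4), (0, 5)]
  | .r9_1 => ![(1, 3), (0, 5), (5, 4), (4, 3), (4, 0), (0, 1)]
  | .r9_2 => ![(1, 1), (0, 1), (1, 3), (4, 5), (2, 2), (3, 0)]
  | .r10_1 => ![(3, 3), (5, 5), (0, 5), (1, 3), (4, 1), (5, 2)]
  | .r11_1 => ![(3, 3), (3, 0), (4, 0), (5, 3), (2, 5), (1, 4)]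
  | .r12_1 => ![(3, 2), (5, 5), (4, 5), (0, 3), (0, 1), (2, 0)]
  | .r15_1 => ![(0, 1), (0, 3), (3, 5), (4, 5), (5, 1), (1, 0)]

/-- The consistent words for six vertices; for each of them the name and a relabelling. -/
def k6Table : List (ℕ × K6Name × (Fin 6 → Fin 6)) := [
  (0, .r5_1, ![5, 0, 1, 2, 3, 4]),
  (1, .r4_1, ![2, 1, 0, 3, 4, 5]),
  (3, .r5_2, ![2, 1, 0, 3, 4, 5]),
  (7, .r4_1, ![4, 5, 1, 0, 3, 2]),
  (8, .r4_1, ![2, 4, 3, 0, 1, 5]),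
  (12, .r5_2, ![2, 4, 3, 0, 1, 5]),
  (14, .r4_1, ![4, 3, 0, 1, 5, 2]),
  (15, .r5_1, ![0, 1, 2, 3, 4, 5]),
  (19, .r8_2, ![5, 0, 1, 4, 3, 2]),
  (23, .r7_1, ![2, 1, 5, 0, 3, 4]),
  (31, .r8_2, ![2, 1, 0, 4, 3, 5]),
  (55, .r8_1, ![5, 4, 3, 0, 1, 2]),
  (63, .r9_2, ![1, 2, 3, 4, 0, 5]),
  (72, .r5_2, ![2, 5, 1, 0, 3, 4]),
  (76, .r6_1, ![1, 3, 2, 4, 0, 5]),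
  (78, .r5_2, ![1, 2, 3, 4, 0, 5]),
  (108, .r9_2, ![5, 1, 0, 2, 4, 3]),
  (110, .r8_1, ![2, 3, 0, 4, 1, 5]),
  (126, .r9_1, ![1, 2, 3, 4, 0, 5]),
  (127, .r12_1, ![1, 2, 3, 4, 0, 5]),
  (183, .r7_2, ![4, 5, 0, 1, 2, 3]),
  (191, .r8_2, ![0, 1, 2, 3, 4, 5]),
  (254, .r8_1, ![4, 5, 1, 2, 0, 3]),
  (255, .r11_1, ![2, 1, 5, 4, 0, 3]),
  (328, .r4_1, ![4, 2, 5, 1, 0, 3]),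
  (332, .r5_2, ![1, 5, 0, 4, 3, 2]),
  (364, .r8_1, ![2, 5, 1, 4, 0, 3]),
  (492, .r9_1, ![1, 5, 0, 4, 3, 2]),
  (508, .r8_1, ![4, 3, 0, 2, 1, 5]),
  (510, .r9_2, ![2, 1, 0, 5, 4, 3]),
  (511, .r12_1, ![2, 3, 4, 5, 0, 1]),
  (512, .r4_1, ![2, 4, 5, 1, 0, 3]),
  (513, .r3_1, ![0, 1, 2, 3, 4, 5]),
  (515, .r4_1, ![1, 5, 4, 0, 3, 2]),
  (531, .r7_2, ![0, 5, 4, 1, 2, 3]),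
  (659, .r8_1, ![3, 4, 5, 0, 1, 2]),
  (691, .r7_1, ![1, 5, 4, 0, 3, 2]),
  (695, .r8_2, ![1, 0, 5, 4, 3, 2]),
  (768, .r5_2, ![2, 5, 4, 3, 0, 1]),
  (769, .r4_1, ![1, 2, 3, 0, 4, 5]),
  (832, .r4_1, ![4, 2, 3, 0, 1, 5]),
  (840, .r5_1, ![0, 5, 1, 2, 3, 4]),
  (896, .r8_2, ![5, 2, 3, 4, 1, 0]),
  (897, .r7_2, ![0, 3, 2, 1, 4, 5]),
  (913, .r8_1, ![3, 2, 1, 0, 5, 4]),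
  (915, .r11_1, ![3, 2, 1, 0, 5, 4]),
  (945, .r7_1, ![1, 2, 3, 0, 4, 5]),
  (947, .r10_1, ![1, 2, 3, 0, 4, 5]),
  (951, .r11_1, ![1, 2, 3, 0, 4, 5]),
  (960, .r7_1, ![2, 4, 3, 0, 5, 1]),
  (968, .r8_2, ![2, 5, 3, 4, 0, 1]),
  (992, .r8_1, ![5, 2, 1, 0, 3, 4]),
  (1000, .r9_2, ![1, 5, 0, 4, 3, 2]),
  (1004, .r12_1, ![1, 5, 0, 4, 3, 2]),
  (1008, .r7_2, ![4, 3, 2, 1, 0, 5]),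
  (1009, .r8_2, ![1, 2, 3, 4, 5, 0]),
  (1011, .r11_1, ![1, 5, 4, 0, 3, 2]),
  (1015, .r12_1, ![3, 2, 1, 0, 5, 4]),
  (1016, .r8_2, ![0, 5, 4, 3, 2, 1]),
  (1020, .r11_1, ![2, 3, 0, 4, 5, 1]),
  (1022, .r12_1, ![2, 1, 0, 5, 4, 3]),
  (1023, .r15_1, ![0, 1, 2, 3, 4, 5])]

instance : Fintype K6Name where
  elems := {.r3_1, .r4_1, .r5_1, .r5_2, .r6_1, .r7_1, .r7_2, .r8_1, .r8_2, .r9_1, .r9_2, .r10_1, .r11_1, .r12_1, .r15_1}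
  complete i := by cases i <;> decide

/-! ### Verification for four and five vertices -/

theorem k4_represents (i : Fin 2) :
    Represents (fun x => decide (x ∈ k4Crossings i)) (k4Crossings i) :=
  represents_decide (by revert i; decide +kernel)

theorem k5_represents (i : Fin 3) :
    Represents (fun x => decide (x ∈ k5Crossings i)) (k5Crossings i) :=
  represents_decide (by revert i; decide +kernel)

theorem k4_realization (i : Fin 2) : ∃ A : KRealization 4, A.crossingSet = k4Crossings i :=
  exists_realization (P := k4Points i) (by revert i; decide +kernel) (k4_represents i)
    (by revert i; decide +kernel)

theorem k5_realization (i : Fin 3) : ∃ A : KRealization 5, A.crossingSet = k5Crossings i :=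
  exists_realization (P := k5Points i) (by revert i; decide +kernel) (k5_represents i)
    (by revert i; decide +kernel)

theorem k4_surjective {R : Fin 2 → KRealization 4}
    (hR : ∀ i, (R i).crossingSet = k4Crossings i) : Function.Surjective fun i => (R i).toClass :=
  surjective_toClass_of_table hR k4_represents (by decide) k4Table (by decide +kernel)
    (by decide +kernel)

theorem k5_surjective {R : Fin 3 → KRealization 5}
    (hR : ∀ i, (R i).crossingSet = k5Crossings i) : Function.Surjective fun i => (R i).toClass :=
  surjective_toClass_of_table hR k5_represents (by decide) k5Table (by decide +kernel)
    (by decide +kernel)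

/-! ### Verification of the realizations and words for six vertices -/

/-- The number whose binary digits `1` are at the codes of the crossings. -/
def K6Name.mask : K6Name → ℕ
  | .r3_1 => 19342822337206103650074880
  | .r4_1 => 19493928841285912622006528
  | .r5_1 => 19418370978685883173109760
  | .r5_2 => 19418370977559998298652928
  | .r6_1 => 75585533844226058551296
  | .r7_1 => 96865264306970511496184064
  | .r7_2 => 19361711803702748387475712
  | .r8_1 => 19493929059147544596054272
  | .r8_2 => 19437260444617499193966592
  | .r9_1 => 96789651103014575067431168
  | .r9_2 => 96789651104140459941888000
  | .r10_1 => 96865264308659363503931648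
  | .r11_1 => 96865264524832143470231808
  | .r12_1 => 96789651104703427075178752
  | .r15_1 => 96808540570635043096035584

/-- Membership in `K6Name.crossings`, for pairs of disjoint edges. -/
def K6Name.hasCrossing (i : K6Name) (x : Sym2 (Sym2 (Fin 6))) : Bool :=
  i.mask.testBit (pairCode sixWeights x)

theorem k6_hasCrossing_of_mem : ∀ i : K6Name, ∀ x ∈ i.crossings, i.hasCrossing x = true := by
  decide +kernel

/-- The converse of `k6_hasCrossing_of_mem`, for disjoint edges only: the mask is not required to be
meaningful for edges with a common end. -/
theorem k6_mem_of_hasCrossing : ∀ i : K6Name, ∀ a b : Fin 6, a < b → ∀ c, b < c → ∀ d, c < d →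
    (i.hasCrossing s(s(a, b), s(c, d)) = true → s(s(a, b), s(c, d)) ∈ i.crossings) ∧
    (i.hasCrossing s(s(a, c), s(b, d)) = true → s(s(a, c), s(b, d)) ∈ i.crossings) ∧
    (i.hasCrossing s(s(a, d), s(b, c)) = true → s(s(a, d), s(b, c)) ∈ i.crossings) := by
  decide +kernel

theorem k6_disjointPair : ∀ i : K6Name, ∀ x ∈ i.crossings, disjointPair x = true := by
  decide +kernel

theorem k6_represents (i : K6Name) : Represents i.hasCrossing i.crossings := by
  refine ⟨k6_disjointPair i, fun x hx => ⟨?_, k6_hasCrossing_of_mem i x⟩⟩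
  induction x using Sym2.ind with | _ e f =>
  induction e using Sym2.ind with | _ a b =>
  induction f using Sym2.ind with | _ c d =>
  revert hx
  refine forall_of_sorted (Q := fun a b c d => disjointPair s(s(a, b), s(c, d)) = true →
    i.hasCrossing s(s(a, b), s(c, d)) = true → s(s(a, b), s(c, d)) ∈ i.crossings) ?_ ?_ ?_ ?_ a b c d
  · intro a b c d h
    rwa [Sym2.eq_swap (a := b)]
  · intro a b c d h
    rwa [Sym2.eq_swap (a := s(c, d))]
  · intro a b c d h h'
    exact absurd (disjointPair_iff.1 h') h
  · intro a b c d hab hbc hcd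
    obtain ⟨h1, h2, h3⟩ := k6_mem_of_hasCrossing i a b hab c hbc d hcd
    exact ⟨fun _ => h1, fun _ => h2, fun _ => h3⟩

theorem k6_generalPosition : ∀ i : K6Name, GeneralPosition i.points := by
  decide +kernel

theorem k6_points_signsMatch : ∀ i : K6Name, SignsMatch
    (fun a b c => decide (0 < orientInt (i.points a) (i.points b) (i.points c))) id
    i.hasCrossing := by
  decide +kernel

theorem k6_realization (i : K6Name) : ∃ A : KRealization 6, A.crossingSet = i.crossings :=
  exists_realization (k6_generalPosition i) (k6_represents i) (k6_points_signsMatch i)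

/-- Realizability of a word is not decided here. Consistency is only necessary, but it suffices
because the table sends each of the listed words to a set realized by points. -/
theorem k6_words : ∀ w < 2 ^ (6 - 1).choose 3, WordConsistent 6 w → w ∈ k6Table.map Prod.fst := by
  decide +kernel

theorem k6_table : ∀ x ∈ k6Table, Function.Injective x.2.2 ∧
    SignsMatch (fun a b c => wordSign x.1 a b c) x.2.2 x.2.1.hasCrossing := by
  decide +kernel

theorem k6_surjective {R : K6Name → KRealization 6}
    (hR : ∀ i, (R i).crossingSet = i.crossings) : Function.Surjective fun i => (R i).toClass :=
  surjective_toClass_of_table hR k6_represents le_rfl k6Table k6_words k6_table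

/-! ### Verification of the Hasse diagram -/

/-- A chain of at most `k` steps in the Hasse diagram leads from one name to the other. -/
def K6Name.reaches : ℕ → K6Name → K6Name → Bool
  | 0, i, j => decide (i = j)
  | k + 1, i, j => decide (i = j) || decide (∃ c ∈ i.upperCovers, reaches k c j = true)

/-- For each covering relation, a permutation of the vertices that preserves crossings. -/
def K6Name.coverMap : K6Name → K6Name → Fin 6 → Fin 6
  | .r3_1, .r8_1 => ![0, 3, 2, 1, 5, 4]
  | .r4_1, .r7_2 => ![1, 0, 3, 2, 4, 5]
  | .r4_1, .r8_2 => ![1, 0, 5, 2, 3, 4]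
  | .r4_1, .r9_2 => ![2, 1, 5, 3, 4, 0]
  | .r5_1, .r10_1 => ![1, 2, 3, 4, 5, 0]
  | .r5_2, .r8_1 => ![0, 4, 5, 1, 2, 3]
  | .r5_2, .r8_2 => ![1, 0, 5, 4, 3, 2]
  | .r8_2, .r11_1 => ![2, 1, 5, 4, 0, 3]
  | .r8_2, .r12_1 => ![2, 3, 4, 5, 0, 1]
  | _, _ => id

theorem k6_coverMap : ∀ i : K6Name, ∀ j ∈ i.upperCovers, Function.Injective (i.coverMap j) ∧
    ∀ x ∈ i.crossings, x.map (Sym2.map (i.coverMap j)) ∈ j.crossings := by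
  decide +kernel

/-- Pairs of names of which the first is not below the second, and which account for all such
pairs. -/
def k6Separated : List (K6Name × K6Name) := [
  (.r3_1, .r8_2), (.r3_1, .r9_2), (.r4_1, .r5_1), (.r4_1, .r6_1), (.r4_1, .r9_1),
    (.r5_1, .r6_1), (.r5_1, .r7_1), (.r5_1, .r7_2), (.r5_1, .r8_1), (.r5_1, .r9_1),
    (.r5_2, .r7_2), (.r5_2, .r9_2), (.r5_2, .r10_1), (.r6_1, .r7_2), (.r6_1, .r9_1),
    (.r6_1, .r10_1), (.r6_1, .r11_1), (.r7_1, .r8_1), (.r7_1, .r15_1), (.r7_2, .r10_1),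
    (.r7_2, .r11_1), (.r7_2, .r12_1), (.r8_1, .r15_1), (.r9_1, .r11_1), (.r10_1, .r11_1)]

/-- The arrangements are the outer loop, so one pass over the 720 permutations treats all pairs; for
each, some crossing is sent to a code outside the target mask. -/
theorem k6_separated_noEmbedding :
    allArrangements [1, 2, 6, 10, 13, 16] (fun w => k6Separated.all fun p =>
      decide (∃ x ∈ p.1.crossings, p.2.mask.testBit (pairCode w x) = false)) = true := by
  decide +kernel

/-- If `i` were below `j`, then `p.1 ≤ i ≤ j ≤ p.2` would contradict the separation of `p`. Three
steps suffice, since no chain in the diagram is longer. -/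
theorem k6_separated_complete : ∀ i j, K6Name.reaches 3 i j = false →
    ∃ p ∈ k6Separated, K6Name.reaches 3 p.1 i = true ∧ K6Name.reaches 3 j p.2 = true := by
  decide +kernel

/-- No listed arrow is implied by the others; the right side has the form of
`covBy_iff_lt_and_eq_or_eq`. -/
theorem k6_upperCovers_iff : ∀ i j : K6Name, j ∈ i.upperCovers ↔
    (K6Name.reaches 3 i j = true ∧ i ≠ j) ∧
    ∀ k, K6Name.reaches 3 i k = true → K6Name.reaches 3 k j = true → k = i ∨ k = j := by
  decide +kernel

theorem k6_reaches_antisymm : ∀ i j, K6Name.reaches 3 i j = true → K6Name.reaches 3 j i = true →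
    i = j := by
  decide +kernel

theorem k6_card : ∀ i : K6Name, i.crossings.card = i.count := by
  decide +kernel

/-! ### The posets for three, four and five vertices -/

/-- A crossing needs four different vertices, so all realizations are plane and any bijection is an
isomorphism. -/
theorem k3_exists_plane : ∃ A : KRealization 3, A.IsPlane ∧ ∀ x : KPoset 3, x = A.toClass := by
  have hD : ∀ a b c d : Fin 3, ¬ Distinct4 a b c d := by decide
  have hno : ∀ (A : KRealization 3) (a b c d : Fin 3), ¬ A.Crosses a b c d := fun A a b c d h =>
    hD a b c d ((A.crosses_iff a b c d).1 h).1
  obtain ⟨A, -⟩ := exists_realization (P := (![(0, 0), (1, 0), (0, 1)] : Fin 3 → ℤ × ℤ)) (F := ∅)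
    (m := fun x => decide (x ∈ (∅ : Finset (Sym2 (Sym2 (Fin 3)))))) (by decide +kernel)
    (represents_decide (by simp)) (by decide +kernel)
  refine ⟨A, hno A, ?_⟩
  rintro ⟨B⟩
  exact Quotient.sound (Realization.equiv_of_crosses_iff (σ := id) (π := id) Function.bijective_id
    Function.bijective_id fun a b c d => iff_of_false (hno B a b c d) (hno A a b c d))

theorem k4_chain : ∃ A B : KRealization 4, A.IsPlane ∧ B.crossingSet = {s(s(1, 3), s(2, 4))} ∧
    A.toClass < B.toClass ∧ (∀ x : KPoset 4, x = A.toClass ∨ x = B.toClass) ∧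
    (∀ x : KPoset 4, IsMin x ↔ x = A.toClass) ∧ (∀ x : KPoset 4, IsMax x ↔ x = B.toClass) := by
  choose R hR using k4_realization
  have hlt : (R 0).toClass < (R 1).toClass :=
    Realization.toClass_lt (hR 0) (hR 1) id Function.injective_id (by simp [k4Crossings])
      (by decide +kernel)
  have hall : ∀ x : KPoset 4, x = (R 0).toClass ∨ x = (R 1).toClass := by
    intro x
    obtain ⟨i, rfl⟩ := k4_surjective hR x
    fin_cases i
    · exact Or.inl rfl
    · exact Or.inr rfl
  refine ⟨R 0, R 1, fun a b c d h => ?_, by simp [hR, k4Crossings], hlt, hall, fun x => ?_,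
    fun x => ?_⟩
  · rw [← Realization.mem_crossingSet, hR] at h
    simp [k4Crossings] at h
  · rcases hall x with rfl | rfl
    · refine iff_of_true (fun y hy => ?_) rfl
      rcases hall y with rfl | rfl
      · exact le_rfl
      · exact absurd hy hlt.not_ge
    · exact iff_of_false (fun h => (h hlt.le).not_gt hlt) hlt.ne'
  · rcases hall x with rfl | rfl
    · exact iff_of_false (fun h => (h hlt.le).not_gt hlt) hlt.ne
    · refine iff_of_true (fun y hy => ?_) rfl
      rcases hall y with rfl | rfl
      · exact absurd hy hlt.not_ge
      · exact le_rfl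

theorem k5_chain : ∃ R : Fin 3 → KRealization 5,
    (∀ i, (R i).crossingSet = (k5Crossings i : Set (Sym2 (Sym2 (Fin 5))))) ∧
    (∀ i, (R i).crossingSet.ncard = 2 * (i : ℕ) + 1) ∧
    StrictMono (fun i => (R i).toClass) ∧ Function.Surjective (fun i => (R i).toClass) := by
  choose R hR using k5_realization
  refine ⟨R, hR, fun i => ?_, ?_, k5_surjective hR⟩
  · rw [hR, Set.ncard_coe_finset]
    revert i
    decide +kernel
  -- The labels are chosen so that the three crossing sets are nested, hence the identity maps.
  · refine Fin.strictMono_iff_lt_succ.2 fun i => ?_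
    fin_cases i
    · exact Realization.toClass_lt (hR 0) (hR 1) id Function.injective_id
        (by decide +kernel) (by decide +kernel)
    · exact Realization.toClass_lt (hR 1) (hR 2) id Function.injective_id (by decide +kernel)
        (by decide +kernel)

/-! ### The poset for six vertices -/

section K6

variable {R : K6Name → KRealization 6}

theorem k6_le_of_reaches (hR : ∀ i, (R i).crossingSet = i.crossings) (k : ℕ) :
    ∀ i j, K6Name.reaches k i j = true → (R i).toClass ≤ (R j).toClass := by
  induction k with
  | zero =>
    intro i j h
    rw [of_decide_eq_true h]
  | succ k ih =>
    intro i j h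
    rw [K6Name.reaches, Bool.or_eq_true, decide_eq_true_iff, decide_eq_true_iff] at h
    rcases h with rfl | ⟨c, hc, h⟩
    · exact le_rfl
    · obtain ⟨hinj, hmap⟩ := k6_coverMap i c hc
      exact le_trans (Realization.toClass_le_iff.2
        ((Realization.precedes_iff (hR i) (hR c)).2 ⟨_, hinj, hmap⟩)) (ih c j h)

/-- An embedding would send every crossing to one whose code is a digit `1` of the target mask. Only
this direction of the mask is used, so codes need not be injective here. -/
theorem k6_not_precedes (hR : ∀ i, (R i).crossingSet = i.crossings) {p : K6Name × K6Name}
    (hp : p ∈ k6Separated) : ¬ (R p.1).Precedes (R p.2) := by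
  intro h
  obtain ⟨f, hf, hsub⟩ := (Realization.precedes_iff (hR p.1) (hR p.2)).1 h
  have hw : Function.Injective sixWeights := by decide +kernel
  have hl : ∀ i, sixWeights i ∈ [1, 2, 6, 10, 13, 16] := by decide +kernel
  have h1 := List.all_eq_true.1 (allArrangements_apply k6_separated_noEmbedding (hw.comp hf)
    fun i => hl (f i)) p hp
  obtain ⟨x, hx, hx'⟩ := of_decide_eq_true h1
  have h2 := k6_hasCrossing_of_mem p.2 _ (hsub x hx)
  rw [K6Name.hasCrossing, pairCode_map, hx'] at h2
  exact Bool.false_ne_true h2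

theorem k6_le_iff (hR : ∀ i, (R i).crossingSet = i.crossings) (i j : K6Name) :
    (R i).toClass ≤ (R j).toClass ↔ K6Name.reaches 3 i j = true := by
  refine ⟨fun h => ?_, k6_le_of_reaches hR 3 i j⟩
  by_contra h'
  obtain ⟨p, hp, h1, h2⟩ := k6_separated_complete i j (Bool.eq_false_iff.2 h')
  exact k6_not_precedes hR hp (Realization.toClass_le_iff.1
    ((k6_le_of_reaches hR 3 _ _ h1).trans (h.trans (k6_le_of_reaches hR 3 _ _ h2))))

/-- Isomorphic realizations are below each other, so injectivity is antisymmetry of reachability in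
the diagram. -/
theorem k6_bijective (hR : ∀ i, (R i).crossingSet = i.crossings) :
    Function.Bijective fun i => (R i).toClass :=
  ⟨fun i j h => k6_reaches_antisymm i j ((k6_le_iff hR i j).1 (le_of_eq h))
    ((k6_le_iff hR j i).1 (ge_of_eq h)), k6_surjective hR⟩

theorem k6_covBy_iff (hR : ∀ i, (R i).crossingSet = i.crossings) (i j : K6Name) :
    (R i).toClass ⋖ (R j).toClass ↔ j ∈ i.upperCovers := by
  have hinj : ∀ i j, (R i).toClass = (R j).toClass ↔ i = j := fun i j =>
    (k6_bijective hR).injective.eq_iff (a := i) (b := j)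
  -- Surjectivity lets the intermediate class range over the fifteen names, which leaves the finite
  -- statement `k6_upperCovers_iff`.
  rw [covBy_iff_lt_and_eq_or_eq, lt_iff_le_and_ne, (k6_bijective hR).surjective.forall,
    k6_upperCovers_iff]
  simp only [k6_le_iff hR, hinj, ne_eq]

end K6

end GeomGraph

theorem mainTheorem6 :
    -- the poset for three vertices has one element, the plane realization
    (∃ A : GeomGraph.KRealization 3, A.IsPlane ∧ ∀ x : GeomGraph.KPoset 3, x = A.toClass) ∧
    -- the poset for four vertices is a chain of two elements
    (∃ A B : GeomGraph.KRealization 4,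
      A.IsPlane ∧ B.crossingSet = {s(s(1, 3), s(2, 4))} ∧
      A.toClass < B.toClass ∧
      (∀ x : GeomGraph.KPoset 4, x = A.toClass ∨ x = B.toClass) ∧
      (∀ x : GeomGraph.KPoset 4, IsMin x ↔ x = A.toClass) ∧
      (∀ x : GeomGraph.KPoset 4, IsMax x ↔ x = B.toClass)) ∧
    -- the poset for five vertices is a chain of three elements
    (∃ R : Fin 3 → GeomGraph.KRealization 5,
      (∀ i, (R i).crossingSet = (GeomGraph.k5Crossings i : Set (Sym2 (Sym2 (Fin 5))))) ∧
      (∀ i, (R i).crossingSet.ncard = 2 * (i : ℕ) + 1) ∧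
      StrictMono (fun i => (R i).toClass) ∧
      Function.Surjective (fun i => (R i).toClass)) ∧
    -- the fifteen elements and the Hasse diagram of the poset for six vertices
    (∃ R : GeomGraph.K6Name → GeomGraph.KRealization 6,
      (∀ i, (R i).crossingSet = (i.crossings : Set (Sym2 (Sym2 (Fin 6))))) ∧
      (∀ i, (R i).crossingSet.ncard = i.count) ∧
      Function.Bijective (fun i => (R i).toClass) ∧
      Nat.card (GeomGraph.KPoset 6) = 15 ∧
      ∀ i j, (R i).toClass ⋖ (R j).toClass ↔ j ∈ i.upperCovers) := by
  refine ⟨GeomGraph.k3_exists_plane, GeomGraph.k4_chain, GeomGraph.k5_chain, ?_⟩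
  choose R hR using GeomGraph.k6_realization
  refine ⟨R, hR, fun i => ?_, GeomGraph.k6_bijective hR, ?_, GeomGraph.k6_covBy_iff hR⟩
  · rw [hR, Set.ncard_coe_finset, GeomGraph.k6_card]
  · rw [← Nat.card_congr (Equiv.ofBijective _ (GeomGraph.k6_bijective hR)),
      Nat.card_eq_fintype_card]
    decide +kernel
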